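/- **Setting.** $\mathbf h$ and $\mathcal H$ are complex separable Hilbert spaces (inner products antilinear in the first variable), $\Omega\in\mathcal H$ is a unit vector, and $\{U_{s,t}:0\le s\le t<\infty\}$ are unitary operators on $\mathbf h\otimes\mathcal H$; $U_t:=U_{0,t}$. For $A\in\mathcal B(\mathbf h\otimes\mathcal H)$ and $u,v\in\mathbf h$, $A(u,v)\in\mathcal B(\mathcal H)$ is defined by $\langle\xi,A(u,v)\zeta\rangle=\langle u\otimes\xi,A(v\otimes\zeta)\rangle$; $A^{(0)}:=A$, $A^{(1)}:=A^*$. For product vectors $\underline u=\otimes_{i=1}^nu_i$, $\underline v=\otimes_{i=1}^nv_i$, for $\underline\epsilon\in\mathbb Z_2^n$ and times $\underline s=(s_i)$, $\underline t=(t_i)$ put $$U^{(\underline\epsilon)}_{\underline s,\underline t}(\underline u,\underline v)=U^{(\epsilon_1)}_{s_1,t_1}(u_1,v_1)\cdots U^{(\epsilon_n)}_{s_n,t_n}(u_n,v_n),$$ write $U_{s,t}^{(\underline\epsilon)}(\underline u,\underline v)$ when all $s_i=s$, $t_i=t$, put $U_t^{(\underline\epsilon)}:=U_{0,t}^{(\underline\epsilon)}$,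 and $(U_t^{(\underline\epsilon)}-1)(\underline u,\underline v)=U_t^{(\underline\epsilon)}(\underline u,\underline v)-\langle\underline u,\underline v\rangle 1$ with $\langle\underline u,\underline v\rangle=\prod_i\langle u_i,v_i\rangle$. Assume: * (A1) $U_{r,s}U_{s,t}=U_{r,t}$ for $0\le r\le s\le t$. * (A2) If $0\le s_i\le t_i$ ($i=1,2$) and $[s_1,t_1)\cap[s_2,t_2)=\emptyset$, then $U_{s_1,t_1}(u_1,v_1)$ commutes with $U_{s_2,t_2}(u_2,v_2)$ and with $U_{s_2,t_2}^*(u_2,v_2)$ for all $u_i,v_i\in\mathbf h$; and for $s_1\le a_1\le b_1\le a_2\le\dots\le b_n\le t_1$, $s_2\le q_1\le r_1\le q_2\le\dots\le r_m\le t_2$, all product vectors and all $\underline\epsilon\in\mathbb Z_2^n$, $\underline\epsilon'\in\mathbb Z_2^m$, $$\langle\Omega,U^{(\underline\epsilon)}_{\underline a,\underline b}(\underline u,\underline v)U^{(\underline\epsilon')}_{\underline q,\underline r}(\underline p,\underline w)\Omega\rangle=\langle\Omega,U^{(\underline\epsilon)}_{\underline a,\underline b}(\underline u,\underline v)\Omega\rangle\langle\Omega,U^{(\underline\epsilon')}_{\underline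 q,\underline r}(\underline p,\underline w)\Omega\rangle.$$ * (A3) $\langle\Omega,U_{s,t}^{(\underline\epsilon)}(\underline u,\underline v)\Omega\rangle=\langle\Omega,U_{t-s}^{(\underline\epsilon)}(\underline u,\underline v)\Omega\rangle$ for $0\le s\le t$. * (B′) $\lim_{t\downarrow0}\langle\Omega,(U_t-1)(u,v)\Omega\rangle=0$ for all $u,v\in\mathbf h$. * (C) $\lim_{t\downarrow0}\frac1t\langle\Omega,(U_t^{(\epsilon_1)}-1)(u_1,v_1)(U_t^{(\epsilon_2)}-1)(u_2,v_2)(U_t^{(\epsilon_3)}-1)(u_3,v_3)\Omega\rangle=0$ for all $u_i,v_i\in\mathbf h$, $\epsilon_i\in\mathbb Z_2$. * (D) The vectors $U_{s_1,t_1}(u_1,v_1)\cdots U_{s_n,t_n}(u_n,v_n)\Omega$ with $n\ge1$, $0\le s_1\le t_1\le s_2\le\dots\le t_n$, $u_i,v_i\in\mathbf h$ are total in $\mathcal H$. Let $T_t\in\mathcal B(\mathbf h)$ be given by $\langle\phi,T_t\psi\rangle=\langle\Omega,U_t(\phi,\psi)\Omega\rangle$, with generator $G$ and domain $\mathcal D(G)=\{v:\lim_{t\downarrow0}\frac1t(T_tv-v)\text{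 exists}\}$. Let $Z_t\rho=\mathrm{Tr}_{\mathcal H}[U_t(\rho\otimes|\Omega\rangle\langle\Omega|)U_t^*]$ on the Banach space $\mathcal B_1(\mathbf h)$ of trace class operators, with generator $\mathcal L$, so that $\mathcal D(\mathcal L)$ is the set of $\rho\in\mathcal B_1(\mathbf h)$ for which $\frac1t(Z_t\rho-\rho)$ converges in trace norm as $t\downarrow0$. Let $M_0$ be the set of $(\underline u,\underline v,\underline\epsilon)$ with $n\ge1$, $\underline u=\otimes_{i=1}^nu_i$, $\underline v=\otimes_{i=1}^nv_i$, $u_i\in\mathbf h$, $v_i\in\mathcal D(G)$, $\underline\epsilon\in\mathbb Z_2^n$. Put $(\underline u,\underline v,\underline\epsilon)\sim(\underline p,\underline w,\underline\epsilon')$ if $\underline\epsilon=\underline\epsilon'$ and $|\underline u\rangle\langle\underline v|=|\underline p\rangle\langle\underline w|$ on $\mathbf h^{\otimes n}$. Let $M$ be the complex algebra with linear basis $M_0/{\sim}$ and multiplication $(\underline u,\underline v,\underline\epsilon)(\underline p,\underline w,\underline\epsilon')=(\underline u\otimes\underline p,\underline v\otimes\underline w,\underline\epsilon\oplus\underline\epsilon')$.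 **Proposition.** Suppose $\mathcal N_0:=\mathrm{span}\{|u\rangle\langle v|:u,v\in\mathcal D(G)\}\subseteq\mathcal D(\mathcal L)$. Then: (i) The limits $$K\big((\underline u,\underline v,\underline\epsilon),(\underline p,\underline w,\underline\epsilon')\big)=\lim_{t\downarrow0}\frac1t\big\langle(U_t^{(\underline\epsilon)}-1)(\underline u,\underline v)\Omega,(U_t^{(\underline\epsilon')}-1)(\underline p,\underline w)\Omega\big\rangle$$ exist for all pairs of elements of $M_0$, depend only on the classes modulo $\sim$, and extend to a map $K$ on $M\times M$ (antilinear in the first, linear in the second variable) that is a positive definite kernel, i.e. $\sum_{i,j}\bar c_ic_jK(m_i,m_j)\ge0$ for all finite families $m_i\in M$, $c_i\in\mathbb C$. (ii) There exist a separable Hilbert space $\mathbf k$, a linear map $\eta:M\to\mathbf k$ and a representation (algebra homomorphism) $\pi:M\to\mathcal B(\mathbf k)$ such that $\eta(M_0)$ is total in $\mathbf k$, $\langle\eta(a),\eta(b)\rangle=K(a,b)$ for $a,b\in M$, and $$\pi(\underline u,\underline v,\underline\epsilon)\,\eta(\underline p,\underline w,\underline\epsilon')=\eta(\underline u\otimes\underline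 p,\underline v\otimes\underline w,\underline\epsilon\oplus\underline\epsilon')-\langle\underline p,\underline w\rangle\,\eta(\underline u,\underline v,\underline\epsilon).$$ The triple is unique up to unitary equivalence: for any other such $(\mathbf k',\eta',\pi')$ there is a unitary $W:\mathbf k\to\mathbf k'$ with $W\eta(a)=\eta'(a)$ and $W\pi(a)=\pi'(a)W$ for all $a\in M$. Moreover $\pi$ is trivial: $\pi(\underline u,\underline v,\underline\epsilon)=\langle\underline u,\underline v\rangle1_{\mathbf k}$. (iii) $\eta(\underline u,\underline v,\underline\epsilon)=\sum_{i=1}^n\prod_{k\ne i}\langle u_k,v_k\rangle\,\eta(u_i,v_i,\epsilon_i)$ for every $(\underline u,\underline v,\underline\epsilon)\in M_0$. (iv) $\eta(u,v,1)=-\eta(u,v,0)$ for all $u\in\mathbf h$, $v\in\mathcal D(G)$. (v) With $\eta(u,v):=\eta(u,v,0)$, the closed linear span of $\{\eta(u,v):u\in\mathbf h,\ v\in\mathcal D(G)\}$ is $\mathbf k$. -/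

import Mathlib

open Filter Topology
open scoped TensorProduct InnerProductSpace ENNReal ComplexOrder

universe u v w

noncomputable section

namespace NoiseSpace

variable {h : Type u} {H : Type v}
variable [NormedAddCommGroup h] [InnerProductSpace ℂ h]
variable [NormedAddCommGroup H] [InnerProductSpace ℂ H]

/-! ### Hilbert tensor product, matrix elements -/

/-- The Hilbert space tensor product of `h` and `H`: the completion of the algebraic one for the
inner product with `⟪a ⊗ b, c ⊗ d⟫ = ⟪a, c⟫ * ⟪b, d⟫`. -/
abbrev HTensor (h : Type u) (H : Type v) [NormedAddCommGroup h] [InnerProductSpace ℂ h]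
    [NormedAddCommGroup H] [InnerProductSpace ℂ H] : Type (max u v) :=
  UniformSpace.Completion (h ⊗[ℂ] H)

/-- `ξ ↦ x ⊗ ξ`, as a bounded operator from `H` to the Hilbert tensor product. -/
def tensorLeft (x : h) : H →L[ℂ] HTensor h H :=
  UniformSpace.Completion.toComplL ∘L
    (TensorProduct.mk ℂ h H x).mkContinuous ‖x‖ (fun ξ => by simp)

/-- `x ↦ x ⊗ ξ`, as a bounded operator from `h` to the Hilbert tensor product. -/
def tensorRight (ξ : H) : h →L[ℂ] HTensor h H :=
  UniformSpace.Completion.toComplL ∘L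
    ((TensorProduct.mk ℂ h H).flip ξ).mkContinuous ‖ξ‖ (fun x => by simp [mul_comm])

/-- The tensor product `A ⊗ B` of bounded operators, on the Hilbert tensor product. -/
def tensorOp (A : h →L[ℂ] h) (B : H →L[ℂ] H) : HTensor h H →L[ℂ] HTensor h H :=
  (TensorProduct.mapL A B).completion

variable [CompleteSpace h] [CompleteSpace H]

/-- The operator `A(x, y)` on `H` with `⟪ξ, A(x, y) ζ⟫ = ⟪x ⊗ ξ, A (y ⊗ ζ)⟫`. -/
def matEl (A : HTensor h H →L[ℂ] HTensor h H) (x y : h) : H →L[ℂ] H :=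
  (ContinuousLinearMap.adjoint (tensorLeft x)) ∘L A ∘L tensorLeft y

/-- `A^(0) = A` and `A^(1) = A*`. -/
def epsOp (ε : ZMod 2) (A : HTensor h H →L[ℂ] HTensor h H) : HTensor h H →L[ℂ] HTensor h H :=
  if ε = 0 then A else ContinuousLinearMap.adjoint A

/-- For a two-parameter family `U`, the operator
`U_{s,t}^(ε) (x, y) = U_{s₁,t₁}^(ε₁) (x₁, y₁) ⋯ U_{sₙ,tₙ}^(εₙ) (xₙ, yₙ)` on `H`, where `x` and `y`
stand for the product vectors `x₁ ⊗ ⋯ ⊗ xₙ` and `y₁ ⊗ ⋯ ⊗ yₙ`. -/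
def wordOp (U : ℝ → ℝ → HTensor h H →L[ℂ] HTensor h H) {n : ℕ} (s t : Fin n → ℝ)
    (ε : Fin n → ZMod 2) (x y : Fin n → h) : H →L[ℂ] H :=
  (List.ofFn fun i => matEl (epsOp (ε i) (U (s i) (t i))) (x i) (y i)).prod

/-- The scalar product of the product vectors `x₁ ⊗ ⋯ ⊗ xₙ` and `y₁ ⊗ ⋯ ⊗ yₙ`. -/
def prodInner {n : ℕ} (x y : Fin n → h) : ℂ := ∏ i, ⟪x i, y i⟫_ℂ

/-- `(U_t^(ε) - 1) (x, y)` with `U_t = U_{0,t}`, where `x` and `y` stand for product vectors. -/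
def wordDiff (U : ℝ → ℝ → HTensor h H →L[ℂ] HTensor h H) (t : ℝ) {n : ℕ}
    (ε : Fin n → ZMod 2) (x y : Fin n → h) : H →L[ℂ] H :=
  wordOp U (fun _ => 0) (fun _ => t) ε x y - prodInner x y • (1 : H →L[ℂ] H)

/-! ### Standing assumptions -/

/-- `α ≤ s₁ ≤ t₁ ≤ s₂ ≤ t₂ ≤ ⋯ ≤ sₙ ≤ tₙ`. -/
def OrderedFrom (α : ℝ) {n : ℕ} (s t : Fin n → ℝ) : Prop :=
  (∀ i, α ≤ s i ∧ s i ≤ t i) ∧ ∀ i j, i < j → t i ≤ s j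

/-- `α ≤ s₁ ≤ t₁ ≤ s₂ ≤ t₂ ≤ ⋯ ≤ sₙ ≤ tₙ ≤ β`. -/
def OrderedIn (α β : ℝ) {n : ℕ} (s t : Fin n → ℝ) : Prop :=
  OrderedFrom α s t ∧ ∀ i, t i ≤ β

/-- `U_{s,t}` (`0 ≤ s ≤ t`) is a unitary evolution with stationary independent increments with
respect to the unit vector `Ω`. -/
structure IsUnitaryIncrementProcess (U : ℝ → ℝ → HTensor h H →L[ℂ] HTensor h H) (Ω : H) :
    Prop where
  norm_vacuum : ‖Ω‖ = 1
  unitary_mem : ∀ s t, 0 ≤ s → s ≤ t → U s t ∈ unitary (HTensor h H →L[ℂ] HTensor h H)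
  evolution : ∀ r s t, 0 ≤ r → r ≤ s → s ≤ t → U r s ∘L U s t = U r t
  commute : ∀ s₁ t₁ s₂ t₂, 0 ≤ s₁ → s₁ ≤ t₁ → 0 ≤ s₂ → s₂ ≤ t₂ →
    Set.Ico s₁ t₁ ∩ Set.Ico s₂ t₂ = ∅ → ∀ x₁ y₁ x₂ y₂ : h,
      Commute (matEl (U s₁ t₁) x₁ y₁) (matEl (U s₂ t₂) x₂ y₂) ∧
      Commute (matEl (U s₁ t₁) x₁ y₁) (matEl (ContinuousLinearMap.adjoint (U s₂ t₂)) x₂ y₂)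
  independent : ∀ s₁ t₁ s₂ t₂, 0 ≤ s₁ → s₁ ≤ t₁ → 0 ≤ s₂ → s₂ ≤ t₂ →
    Set.Ico s₁ t₁ ∩ Set.Ico s₂ t₂ = ∅ →
    ∀ (n m : ℕ) (a b : Fin n → ℝ) (q r : Fin m → ℝ), OrderedIn s₁ t₁ a b → OrderedIn s₂ t₂ q r →
    ∀ (x y : Fin n → h) (p w : Fin m → h) (ε : Fin n → ZMod 2) (ε' : Fin m → ZMod 2),
      ⟪Ω, wordOp U a b ε x y (wordOp U q r ε' p w Ω)⟫_ℂ =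
        ⟪Ω, wordOp U a b ε x y Ω⟫_ℂ * ⟪Ω, wordOp U q r ε' p w Ω⟫_ℂ
  stationary : ∀ s t, 0 ≤ s → s ≤ t → ∀ (n : ℕ) (x y : Fin n → h) (ε : Fin n → ZMod 2),
    ⟪Ω, wordOp U (fun _ => s) (fun _ => t) ε x y Ω⟫_ℂ =
      ⟪Ω, wordOp U (fun _ => 0) (fun _ => t - s) ε x y Ω⟫_ℂ

/-- Weak continuity: `⟪Ω, (U_t - 1)(x, y) Ω⟫ → 0` as `t ↓ 0`. -/
def IsWeaklyContinuous (U : ℝ → ℝ → HTensor h H →L[ℂ] HTensor h H) (Ω : H) : Prop :=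
  ∀ x y : h, Tendsto (fun t : ℝ => ⟪Ω, matEl (U 0 t - 1) x y Ω⟫_ℂ) (𝓝[>] 0) (𝓝 0)

/-- Gaussian condition: threefold products of increments are `o(t)` in the state `Ω`. -/
def IsGaussian (U : ℝ → ℝ → HTensor h H →L[ℂ] HTensor h H) (Ω : H) : Prop :=
  ∀ (x y : Fin 3 → h) (ε : Fin 3 → ZMod 2),
    Tendsto (fun t : ℝ => (t : ℂ)⁻¹ *
      ⟪Ω, matEl (epsOp (ε 0) (U 0 t) - 1) (x 0) (y 0)
        (matEl (epsOp (ε 1) (U 0 t) - 1) (x 1) (y 1)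
          (matEl (epsOp (ε 2) (U 0 t) - 1) (x 2) (y 2) Ω))⟫_ℂ) (𝓝[>] 0) (𝓝 0)

/-- Minimality: the vectors `U_{s₁,t₁}(x₁,y₁) ⋯ U_{sₙ,tₙ}(xₙ,yₙ) Ω` with
`0 ≤ s₁ ≤ t₁ ≤ s₂ ≤ ⋯ ≤ tₙ`, `n ≥ 1`, are total in `H`. -/
def IsMinimal (U : ℝ → ℝ → HTensor h H →L[ℂ] HTensor h H) (Ω : H) : Prop :=
  (Submodule.span ℂ {ξ : H | ∃ (n : ℕ) (s t : Fin (n + 1) → ℝ) (x y : Fin (n + 1) → h),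
    OrderedFrom 0 s t ∧ ξ = wordOp U s t (fun _ => 0) x y Ω}).topologicalClosure = ⊤

/-! ### Expectation semigroups and the domains of their generators -/

/-- The operator `T_t` on `h` with `⟪x, T_t y⟫ = ⟪Ω, U_t(x, y) Ω⟫ = ⟪x ⊗ Ω, U_t (y ⊗ Ω)⟫`. -/
def semiT (U : ℝ → ℝ → HTensor h H →L[ℂ] HTensor h H) (Ω : H) (t : ℝ) : h →L[ℂ] h :=
  (ContinuousLinearMap.adjoint (tensorRight Ω)) ∘L U 0 t ∘L tensorRight Ω

/-- The domain `𝒟(G)` of the generator of `T_t`. -/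
def domG (U : ℝ → ℝ → HTensor h H →L[ℂ] HTensor h H) (Ω : H) : Set h :=
  {y | ∃ g : h, Tendsto (fun t : ℝ => (t : ℂ)⁻¹ • (semiT U Ω t y - y)) (𝓝[>] 0) (𝓝 g)}

/-- The trace norm `‖ρ‖₁` (possibly infinite): the supremum of `∑ |⟪φ_k, ρ ψ_k⟫|` over (finite
parts of) orthonormal systems. -/
def traceNorm (ρ : h →L[ℂ] h) : ℝ≥0∞ :=
  ⨆ (n : ℕ) (φ : Fin n → h) (ψ : Fin n → h) (_ : Orthonormal ℂ φ) (_ : Orthonormal ℂ ψ),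
    ∑ k, ‖⟪φ k, ρ (ψ k)⟫_ℂ‖ₑ

/-- Trace class operators. -/
def IsTraceClass (ρ : h →L[ℂ] h) : Prop := traceNorm ρ < ∞

/-- The index set of an orthonormal basis of `H`. -/
def basisSet (H : Type v) [NormedAddCommGroup H] [InnerProductSpace ℂ H] [CompleteSpace H] :
    Set H :=
  (exists_hilbertBasis ℂ H).choose

/-- An orthonormal basis of `H`. -/
def onb (H : Type v) [NormedAddCommGroup H] [InnerProductSpace ℂ H] [CompleteSpace H] :
    HilbertBasis (basisSet H) ℂ H :=
  (exists_hilbertBasis ℂ H).choose_spec.choose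

/-- The partial trace over `H`: `∑ⱼ E_j* B E_j` with `E_j x = x ⊗ ζ_j`, `(ζ_j)` an orthonormal
basis of `H`, so that `⟪x, (Tr_H B) y⟫ = ∑ⱼ ⟪x ⊗ ζ_j, B (y ⊗ ζ_j)⟫`. For trace class `B` the series
converges absolutely in trace norm, hence in operator norm, to a limit that does not depend on the
choice of the basis. -/
def partialTrace (B : HTensor h H →L[ℂ] HTensor h H) : h →L[ℂ] h :=
  ∑' j, (ContinuousLinearMap.adjoint (tensorRight (onb H j))) ∘L B ∘L tensorRight (onb H j)

/-- `Z_t ρ = Tr_H [U_t (ρ ⊗ |Ω⟩⟨Ω|) U_t*]`. -/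
def semiZ (U : ℝ → ℝ → HTensor h H →L[ℂ] HTensor h H) (Ω : H) (t : ℝ) (ρ : h →L[ℂ] h) :
    h →L[ℂ] h :=
  partialTrace (U 0 t ∘L tensorOp ρ (InnerProductSpace.rankOne ℂ Ω Ω) ∘L
    ContinuousLinearMap.adjoint (U 0 t))

/-- The domain `𝒟(ℒ)` of the generator of `Z_t` on the Banach space of trace class operators. -/
def domL (U : ℝ → ℝ → HTensor h H →L[ℂ] HTensor h H) (Ω : H) : Set (h →L[ℂ] h) :=
  {ρ | IsTraceClass ρ ∧ ∃ σ : h →L[ℂ] h, IsTraceClass σ ∧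
    Tendsto (fun t : ℝ => traceNorm ((t : ℂ)⁻¹ • (semiZ U Ω t ρ - ρ) - σ)) (𝓝[>] 0) (𝓝 0)}

/-- `𝒩₀`, the span of the operators `|x⟩⟨y|` with `x, y ∈ 𝒟(G)`. -/
def spaceN (U : ℝ → ℝ → HTensor h H →L[ℂ] HTensor h H) (Ω : H) : Submodule ℂ (h →L[ℂ] h) :=
  Submodule.span ℂ {ρ | ∃ x ∈ domG U Ω, ∃ y ∈ domG U Ω, ρ = InnerProductSpace.rankOne ℂ x y}

/-! ### The algebra of tuples -/

section Tuples

variable {E : Type u} [NormedAddCommGroup E] [InnerProductSpace ℂ E]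

/-- The functional `⟪y₁ ⊗ ⋯ ⊗ yₙ, ·⟫` on the algebraic `n`-th tensor power. -/
def bra {n : ℕ} (y : Fin n → E) : (⨂[ℂ]^n E) →ₗ[ℂ] ℂ :=
  PiTensorProduct.lift
    ((MultilinearMap.mkPiAlgebra ℂ (Fin n) ℂ).compLinearMap
      (fun i => (innerSL ℂ (y i)).toLinearMap))

@[simp] theorem bra_tprod {n : ℕ} (y z : Fin n → E) :
    bra y (PiTensorProduct.tprod ℂ z) = ∏ i, ⟪y i, z i⟫_ℂ := by
  simp [bra]

/-- The operator `|x⟩⟨y|` for product vectors `x = x₁ ⊗ ⋯ ⊗ xₙ`, `y = y₁ ⊗ ⋯ ⊗ yₙ`, on the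
algebraic `n`-th tensor power (a dense subspace of the Hilbert space one, so that two such bounded
operators agree if and only if they agree here). -/
def ketBra {n : ℕ} (x y : Fin n → E) : (⨂[ℂ]^n E) →ₗ[ℂ] (⨂[ℂ]^n E) :=
  (bra y).smulRight (PiTensorProduct.tprod ℂ x)

theorem ketBra_append {n m : ℕ} (x y : Fin n → E) (p w : Fin m → E) (z : Fin n → E)
    (z' : Fin m → E) :
    ketBra (Fin.append x p) (Fin.append y w) (PiTensorProduct.tprod ℂ (Fin.append z z')) =
      TensorPower.mulEquiv (ketBra x y (PiTensorProduct.tprod ℂ z) ⊗ₜ[ℂ]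
        ketBra p w (PiTensorProduct.tprod ℂ z')) := by
  have e : (PiTensorProduct.tprod ℂ (Fin.append x p) : ⨂[ℂ]^(n + m) E) =
      TensorPower.mulEquiv (PiTensorProduct.tprod ℂ x ⊗ₜ[ℂ] PiTensorProduct.tprod ℂ p) :=
    (TensorPower.tprod_mul_tprod (R := ℂ) x p).symm
  simp only [ketBra, LinearMap.smulRight_apply, bra_tprod, Fin.prod_univ_add, Fin.append_left,
    Fin.append_right, TensorProduct.tmul_smul, ← TensorProduct.smul_tmul', map_smul, smul_smul, e]
  rw [mul_comm]

theorem ketBra_append_congr {n m : ℕ} {x y x' y' : Fin n → E} {p w p' w' : Fin m → E}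
    (h₁ : ketBra x y = ketBra x' y') (h₂ : ketBra p w = ketBra p' w') :
    ketBra (Fin.append x p) (Fin.append y w) = ketBra (Fin.append x' p') (Fin.append y' w') := by
  refine PiTensorProduct.ext (MultilinearMap.ext fun z => ?_)
  have hz : z = Fin.append (fun i => z (Fin.castAdd m i)) (fun i => z (Fin.natAdd n i)) :=
    Fin.append_castAdd_natAdd.symm
  simp only [LinearMap.compMultilinearMap_apply]
  rw [hz, ketBra_append, ketBra_append, h₁, h₂]

/-- The elements of `M₀`: tuples `(x₁ ⊗ ⋯ ⊗ xₙ, y₁ ⊗ ⋯ ⊗ yₙ, (ε₁, …, εₙ))` with `n ≥ 1`, `xᵢ ∈ E`,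
`yᵢ ∈ D`, `εᵢ ∈ ℤ₂`. -/
structure Tuple (D : Set E) where
  n : ℕ
  pos : 0 < n
  x : Fin n → E
  y : Fin n → E
  mem : ∀ i, y i ∈ D
  ε : Fin n → ZMod 2

namespace Tuple

variable {D : Set E}

/-- `a ∼ b` if `a` and `b` have the same `ε` and the same operator `|x⟩⟨y|`. -/
def Rel (a b : Tuple D) : Prop :=
  ∃ e : a.n = b.n, a.ε = b.ε ∘ Fin.cast e ∧
    ketBra a.x a.y = ketBra (b.x ∘ Fin.cast e) (b.y ∘ Fin.cast e)

instance setoid (D : Set E) : Setoid (Tuple D) where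
  r := Rel
  iseqv :=
    { refl := fun _ => ⟨rfl, rfl, rfl⟩
      symm := by
        rintro ⟨n, _, x, y, _, ε⟩ ⟨n', _, x', y', _, ε'⟩ ⟨e, h₁, h₂⟩
        dsimp only at e
        subst e
        exact ⟨rfl, h₁.symm, h₂.symm⟩
      trans := by
        rintro ⟨n, _, x, y, _, ε⟩ ⟨n', _, x', y', _, ε'⟩ ⟨n'', _, x'', y'', _, ε''⟩
          ⟨e, h₁, h₂⟩ ⟨e', h₁', h₂'⟩
        dsimp only at e e'
        subst e e'
        exact ⟨rfl, h₁.trans h₁', h₂.trans h₂'⟩ }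

/-- Concatenation `(x ⊗ p, y ⊗ w, ε ⊕ ε')`. -/
def mul (a b : Tuple D) : Tuple D where
  n := a.n + b.n
  pos := Nat.add_pos_left a.pos _
  x := Fin.append a.x b.x
  y := Fin.append a.y b.y
  mem := fun i => by
    refine Fin.addCases (fun j => ?_) (fun j => ?_) i
    · simpa using a.mem j
    · simpa using b.mem j
  ε := Fin.append a.ε b.ε

/-- The tuple `(x, y, ε)` with `n = 1`. -/
def single (x y : E) (hy : y ∈ D) (ε : ZMod 2) : Tuple D where
  n := 1
  pos := Nat.one_pos
  x := fun _ => x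
  y := fun _ => y
  mem := fun _ => hy
  ε := fun _ => ε

end Tuple

/-- `M₀ / ∼`. -/
abbrev Words (D : Set E) : Type u := Quotient (Tuple.setoid D)

instance (D : Set E) : Semigroup (Words D) where
  mul := Quotient.map₂ Tuple.mul (by
    rintro ⟨n, _, x, y, _, ε⟩ ⟨n', _, x', y', _, ε'⟩ ⟨e, h₁, h₂⟩
      ⟨m, _, p, w, _, δ⟩ ⟨m', _, p', w', _, δ'⟩ ⟨e', h₁', h₂'⟩
    dsimp only at e e'
    subst e e'
    refine ⟨rfl, ?_, ?_⟩
    · change Fin.append ε δ = Fin.append ε' δ'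
      rw [show ε = ε' from h₁, show δ = δ' from h₁']
    · exact ketBra_append_congr h₂ h₂')
  mul_assoc := by
    rintro ⟨a⟩ ⟨b⟩ ⟨c⟩
    refine Quotient.sound ⟨Nat.add_assoc _ _ _, Fin.append_assoc _ _ _, ?_⟩
    exact congrArg₂ ketBra (Fin.append_assoc _ _ _) (Fin.append_assoc _ _ _)

/-- The algebra `M` generated by `M₀ / ∼`: formal linear combinations of elements of `M₀ / ∼`,
multiplied by bilinear extension of concatenation. -/
abbrev TupleAlgebra (D : Set E) : Type u := MonoidAlgebra ℂ (Words D)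

/-- The element of `M` given by a tuple. -/
def gen {D : Set E} (a : Tuple D) : TupleAlgebra D :=
  MonoidAlgebra.single (Quotient.mk _ a) 1

theorem gen_mul {D : Set E} (a b : Tuple D) : gen a * gen b = gen (a.mul b) := by
  simp only [gen, MonoidAlgebra.single_mul_single, mul_one]
  rfl

end Tuples

/-! ### The kernel and the noise space -/

/-- The sesquilinear map `K` on `M` is the kernel of the process: on tuples the limit
`lim_{t ↓ 0} t⁻¹ ⟪(U_t^(ε) - 1)(x, y) Ω, (U_t^(ε') - 1)(p, w) Ω⟫` exists and is equal to `K`.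
There is at most one such `K`, since the tuples span `M`. -/
def IsKernelOf (U : ℝ → ℝ → HTensor h H →L[ℂ] HTensor h H) (Ω : H)
    (K : TupleAlgebra (domG U Ω) →ₗ⋆[ℂ] TupleAlgebra (domG U Ω) →ₗ[ℂ] ℂ) : Prop :=
  ∀ a b : Tuple (domG U Ω),
    Tendsto (fun t : ℝ => (t : ℂ)⁻¹ *
      ⟪wordDiff U t a.ε a.x a.y Ω, wordDiff U t b.ε b.x b.y Ω⟫_ℂ) (𝓝[>] 0) (𝓝 (K (gen a) (gen b)))

/-- `K` is a positive definite kernel: all matrices `(K(mᵢ, mⱼ))ᵢⱼ` are positive semidefinite. -/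
def IsPositiveDefiniteKernel {M : Type*} (K : M → M → ℂ) : Prop :=
  ∀ (n : ℕ) (m : Fin n → M), (Matrix.of fun i j => K (m i) (m j)).PosSemidef

/-- `(k, η, π)` is a noise space for the kernel `K` on `M`: a Hilbert space `k`, a linear map
`η : M → k` with `⟪η a, η b⟫ = K(a, b)` for which the `η` of tuples are total, and a
representation `π` of the algebra `M` by bounded operators on `k` with
`π(a) η(b) = η(a b) - ⟪p, w⟫ η(a)` for tuples `a` and `b = (p, w, ε')`. -/
structure IsNoiseSpace {E : Type u} [NormedAddCommGroup E] [InnerProductSpace ℂ E] {D : Set E}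
    (K : TupleAlgebra D → TupleAlgebra D → ℂ)
    {k : Type*} [NormedAddCommGroup k] [InnerProductSpace ℂ k]
    (η : TupleAlgebra D →ₗ[ℂ] k) (π : TupleAlgebra D →ₙₐ[ℂ] (k →L[ℂ] k)) : Prop where
  total : (Submodule.span ℂ (Set.range fun a : Tuple D => η (gen a))).topologicalClosure = ⊤
  inner_eq : ∀ a b, ⟪η a, η b⟫_ℂ = K a b
  rep : ∀ a b : Tuple D,
    π (gen a) (η (gen b)) = η (gen a * gen b) - prodInner b.x b.y • η (gen a)

end NoiseSpace

end

noncomputable section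

namespace NoiseSpace

variable {h : Type u} {H : Type v}
variable [NormedAddCommGroup h] [InnerProductSpace ℂ h]
variable [NormedAddCommGroup H] [InnerProductSpace ℂ H]

set_option linter.unusedSectionVars false

open Asymptotics

/-! ### Elementary tensors and matrix elements -/

/-! For a unitary `V` one has `‖(V - 1) z‖ ^ 2 = -2 Re ⟪z, (V - 1) z⟫`, so the size of an increment
is governed by an expectation that is linear in it. Applied to `z = y ⊗ f` with `f` an increment of
`Ω`, the expectation is a vacuum expectation of three increments, hence `o(t)` by the Gaussian
condition: a product of two increments applied to `Ω` has norm `o(√t)` (`negligible_incr_incr`).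
Applied to `z = y ⊗ Ω` with `y ∈ 𝒟(G)`, it gives `O(√t)` for a single increment
(`incr_vacuum_isBigO`).

The kernel only sees vectors modulo `o(√t)`. Modulo such vectors, a word minus its scalar part obeys
the Leibniz rule, so it is a sum of single increments (`negligible_wordDiff_sub_sum`). Unitarity
gives `(V* - 1) + (V - 1) = -(V - 1)*(V - 1)`, and the right side is again negligible on `Ω`, so the
adjoint increment is minus the increment (`negligible_incr_add_incr`). All limits are thereby
reduced to pairs of increments with `ε = 0`. These are expressed through `Z_t` on `|q⟩⟨y|` and
through `T_t`, and converge because `𝒩₀ ⊆ 𝒟(ℒ)` and `y, q ∈ 𝒟(G)` (`tendsto_inner_incr_zero`).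

A limit of Gram kernels is positive, and completing `M` in the resulting seminorm gives `k` and `η`.
Each relation for `η` is a negligibility statement (`IsLimitMap.eq_of_negligible`). The Leibniz rule
turns the formula required of `π` into multiplication by `⟪x, y⟫`, so `π` is a character times the
identity. Separability holds because `η(x, y)` is continuous in `x` and in `y` for the graph norm of
`G`. -/

theorem tensorLeft_apply (x : h) (ξ : H) :
    tensorLeft x ξ = ((x ⊗ₜ[ℂ] ξ : h ⊗[ℂ] H) : HTensor h H) := rfl

theorem tensorRight_apply (ξ : H) (x : h) : tensorRight ξ x = tensorLeft x ξ := rfl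

theorem inner_tensorLeft (x y : h) (ξ ζ : H) :
    ⟪tensorLeft x ξ, tensorLeft y ζ⟫_ℂ = ⟪x, y⟫_ℂ * ⟪ξ, ζ⟫_ℂ := by
  rw [tensorLeft_apply, tensorLeft_apply, UniformSpace.Completion.inner_coe,
    TensorProduct.inner_tmul]

theorem norm_tensorLeft_apply (x : h) (ξ : H) : ‖tensorLeft x ξ‖ = ‖x‖ * ‖ξ‖ := by
  rw [tensorLeft_apply, UniformSpace.Completion.norm_coe, TensorProduct.norm_tmul]

theorem tensorLeft_add (x y : h) :
    (tensorLeft (x + y) : H →L[ℂ] HTensor h H) = tensorLeft x + tensorLeft y := by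
  ext1 ξ
  simp only [← tensorRight_apply, add_apply, map_add]

theorem tensorLeft_smul (c : ℂ) (x : h) :
    (tensorLeft (c • x) : H →L[ℂ] HTensor h H) = c • tensorLeft x := by
  ext1 ξ
  simp only [← tensorRight_apply, smul_apply, map_smul]

section Complete

variable [CompleteSpace h] [CompleteSpace H]

theorem inner_matEl (A : HTensor h H →L[ℂ] HTensor h H) (x y : h) (ξ ζ : H) :
    ⟪ξ, matEl A x y ζ⟫_ℂ = ⟪tensorLeft x ξ, A (tensorLeft y ζ)⟫_ℂ := by
  simp [matEl, ContinuousLinearMap.adjoint_inner_right]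

theorem matEl_one (x y : h) :
    matEl (1 : HTensor h H →L[ℂ] HTensor h H) x y = ⟪x, y⟫_ℂ • (1 : H →L[ℂ] H) := by
  ext1 ζ
  refine ext_inner_left ℂ fun ξ => ?_
  rw [inner_matEl]
  simp [inner_tensorLeft, inner_smul_right]

theorem matEl_sub (A B : HTensor h H →L[ℂ] HTensor h H) (x y : h) :
    matEl (A - B) x y = matEl A x y - matEl B x y := by
  simp [matEl]

theorem matEl_sub_one (A : HTensor h H →L[ℂ] HTensor h H) (x y : h) :
    matEl (A - 1) x y = matEl A x y - ⟪x, y⟫_ℂ • (1 : H →L[ℂ] H) := by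
  rw [matEl_sub, matEl_one]

theorem adjoint_matEl (A : HTensor h H →L[ℂ] HTensor h H) (x y : h) :
    ContinuousLinearMap.adjoint (matEl A x y) = matEl (ContinuousLinearMap.adjoint A) y x := by
  simp only [matEl, ContinuousLinearMap.adjoint_comp, ContinuousLinearMap.adjoint_adjoint,
    ContinuousLinearMap.comp_assoc]

theorem matEl_add_left (A : HTensor h H →L[ℂ] HTensor h H) (x x' y : h) :
    matEl A (x + x') y = matEl A x y + matEl A x' y := by
  simp [matEl, tensorLeft_add]

theorem matEl_add_right (A : HTensor h H →L[ℂ] HTensor h H) (x y y' : h) :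
    matEl A x (y + y') = matEl A x y + matEl A x y' := by
  simp [matEl, tensorLeft_add]

theorem matEl_smul_left (A : HTensor h H →L[ℂ] HTensor h H) (c : ℂ) (x y : h) :
    matEl A (c • x) y = starRingEnd ℂ c • matEl A x y := by
  simp only [matEl, tensorLeft_smul, map_smulₛₗ, ContinuousLinearMap.smul_comp]

theorem matEl_smul_right (A : HTensor h H →L[ℂ] HTensor h H) (c : ℂ) (x y : h) :
    matEl A x (c • y) = c • matEl A x y := by
  simp [matEl, tensorLeft_smul]

theorem norm_matEl_apply_le (A : HTensor h H →L[ℂ] HTensor h H) (x y : h) (ζ : H) :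
    ‖matEl A x y ζ‖ ≤ ‖x‖ * ‖A (tensorLeft y ζ)‖ := by
  refine (ContinuousLinearMap.le_opNorm (ContinuousLinearMap.adjoint (tensorLeft x)) _).trans ?_
  rw [LinearIsometryEquiv.norm_map]
  gcongr
  · exact ContinuousLinearMap.opNorm_le_bound _ (norm_nonneg _)
      fun ξ => (norm_tensorLeft_apply x ξ).le
  · exact le_rfl

theorem matEl_eq_zero_of_left (A : HTensor h H →L[ℂ] HTensor h H) {x : h} (hx : x = 0) (y : h) :
    matEl A x y = 0 := by
  simpa [hx] using matEl_smul_left A 0 x y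

theorem matEl_eq_zero_of_right (A : HTensor h H →L[ℂ] HTensor h H) (x : h) {y : h} (hy : y = 0) :
    matEl A x y = 0 := by
  simpa [hy] using matEl_smul_right A 0 x y

/-! ### Unitary operators -/

/-- Since `‖V z‖ = ‖z‖`, expanding the square leaves `2 ‖z‖ ^ 2 - 2 Re ⟪z, V z⟫`. Every `√t`
estimate below rests on this identity. -/
theorem norm_unitary_sub_one_sq {E : Type*} [NormedAddCommGroup E] [InnerProductSpace ℂ E]
    [CompleteSpace E] {V : E →L[ℂ] E} (hV : V ∈ unitary (E →L[ℂ] E)) (z : E) :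
    ‖(V - 1) z‖ ^ 2 = -2 * (⟪z, (V - 1) z⟫_ℂ).re := by
  have h1 : ‖V z‖ = ‖z‖ := ContinuousLinearMap.norm_map_of_mem_unitary hV z
  have h2 := norm_sub_sq (𝕜 := ℂ) (V z) z
  have h3 : (⟪z, V z⟫_ℂ).re = RCLike.re ⟪V z, z⟫_ℂ := (inner_re_symm (𝕜 := ℂ) z (V z))
  have h4 : (⟪z, z⟫_ℂ).re = ‖z‖ ^ 2 := inner_self_eq_norm_sq (𝕜 := ℂ) z
  simp only [sub_apply, one_apply_eq_self, inner_sub_right, Complex.sub_re, h3, h4, h2,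
    h1]
  ring

/-- The left vector enters only through its norm, so the diagonal matrix element at `(y, y)`
controls all `(x, y)`. -/
theorem norm_matEl_sub_one_sq_le {V : HTensor h H →L[ℂ] HTensor h H}
    (hV : V ∈ unitary (HTensor h H →L[ℂ] HTensor h H)) (x y : h) (ζ : H) :
    ‖matEl (V - 1) x y ζ‖ ^ 2 ≤ ‖x‖ ^ 2 * (-2 * (⟪ζ, matEl (V - 1) y y ζ⟫_ℂ).re) := by
  rw [inner_matEl, ← norm_unitary_sub_one_sq hV, ← mul_pow]
  gcongr
  exact norm_matEl_apply_le _ _ _ _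

theorem norm_matEl_sub_one_le {V : HTensor h H →L[ℂ] HTensor h H}
    (hV : V ∈ unitary (HTensor h H →L[ℂ] HTensor h H)) (x y : h) (ζ : H) :
    ‖matEl (V - 1) x y ζ‖ ≤ 2 * ‖x‖ * ‖y‖ * ‖ζ‖ := by
  refine (norm_matEl_apply_le _ _ _ _).trans ?_
  have h1 : ‖V (tensorLeft y ζ)‖ = ‖(tensorLeft y ζ : HTensor h H)‖ :=
    ContinuousLinearMap.norm_map_of_mem_unitary hV _
  have h2 : ‖(V - 1) (tensorLeft y ζ)‖ ≤ 2 * (‖y‖ * ‖ζ‖) := by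
    have := norm_sub_le (V (tensorLeft y ζ)) (tensorLeft y ζ)
    rw [h1, norm_tensorLeft_apply] at this
    simpa [two_mul] using this
  calc ‖x‖ * ‖(V - 1) (tensorLeft y ζ)‖ ≤ ‖x‖ * (2 * (‖y‖ * ‖ζ‖)) := by gcongr
    _ = _ := by ring

theorem epsOp_zero (A : HTensor h H →L[ℂ] HTensor h H) : epsOp 0 A = A := if_pos rfl

theorem epsOp_one (A : HTensor h H →L[ℂ] HTensor h H) :
    epsOp 1 A = ContinuousLinearMap.adjoint A := if_neg (by decide)

theorem epsOp_mem_unitary {A : HTensor h H →L[ℂ] HTensor h H}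
    (hA : A ∈ unitary (HTensor h H →L[ℂ] HTensor h H)) (ε : ZMod 2) :
    epsOp ε A ∈ unitary (HTensor h H →L[ℂ] HTensor h H) := by
  unfold epsOp
  split_ifs
  · exact hA
  · rw [← ContinuousLinearMap.star_eq_adjoint]
    exact Unitary.star_mem hA

theorem adjoint_epsOp (A : HTensor h H →L[ℂ] HTensor h H) (ε : ZMod 2) :
    ContinuousLinearMap.adjoint (epsOp ε A) = epsOp (ε + 1) A := by
  obtain rfl | rfl : ε = 0 ∨ ε = 1 := by revert ε; decide
  · rw [zero_add, epsOp_zero, epsOp_one]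
  · rw [show (1 + 1 : ZMod 2) = 0 from rfl, epsOp_zero, epsOp_one,
      ContinuousLinearMap.adjoint_adjoint]

/-- An increment moved across the inner product is again an increment, with `x, y` exchanged and `ε`
flipped. Squared norms thus become vacuum expectations of products of increments. -/
theorem inner_matEl_epsOp_sub_one (A : HTensor h H →L[ℂ] HTensor h H) (ε : ZMod 2) (x y : h)
    (ξ ζ : H) :
    ⟪matEl (epsOp ε A - 1) x y ξ, ζ⟫_ℂ = ⟪ξ, matEl (epsOp (ε + 1) A - 1) y x ζ⟫_ℂ := by
  rw [← ContinuousLinearMap.adjoint_inner_right, adjoint_matEl, map_sub, adjoint_epsOp,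
    ← ContinuousLinearMap.star_eq_adjoint 1, star_one]

/-! ### Vectors of order `o(√t)` -/

/-- `‖f t‖ = o(√t)` as `t ↓ 0`. -/
def Negligible {E : Type*} [Norm E] (f : ℝ → E) : Prop :=
  f =o[𝓝[>] 0] fun t : ℝ => √t

theorem eventually_pos : ∀ᶠ t : ℝ in 𝓝[>] 0, 0 < t := self_mem_nhdsWithin

section Negligible

variable {E : Type*} [NormedAddCommGroup E] [InnerProductSpace ℂ E]

theorem negligible_of_sq_le {f : ℝ → E} {g : ℝ → ℝ} (hfg : ∀ᶠ t in 𝓝[>] 0, ‖f t‖ ^ 2 ≤ g t)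
    (hg : g =o[𝓝[>] 0] fun t : ℝ => t) : Negligible f := by
  have h1 : (fun t => ‖f t‖ ^ 2) =o[𝓝[>] 0] fun t : ℝ => √t ^ 2 := by
    refine (IsBigO.of_bound 1 ?_).trans_isLittleO (hg.congr' EventuallyEq.rfl ?_)
    · filter_upwards [hfg] with t ht
      rw [one_mul, Real.norm_of_nonneg (by positivity)]
      exact ht.trans (le_abs_self _)
    · filter_upwards [eventually_pos] with t ht using (Real.sq_sqrt ht.le).symm
  exact (h1.of_pow two_ne_zero).of_norm_left

theorem isBigO_sqrt_of_sq_le {f : ℝ → E} {g : ℝ → ℝ} (hfg : ∀ᶠ t in 𝓝[>] 0, ‖f t‖ ^ 2 ≤ g t)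
    (hg : g =O[𝓝[>] 0] fun t : ℝ => t) : f =O[𝓝[>] 0] fun t : ℝ => √t := by
  have h1 : (fun t => ‖f t‖ ^ 2) =O[𝓝[>] 0] fun t : ℝ => √t ^ 2 := by
    refine (IsBigO.of_bound 1 ?_).trans (hg.congr' EventuallyEq.rfl ?_)
    · filter_upwards [hfg] with t ht
      rw [one_mul, Real.norm_of_nonneg (by positivity)]
      exact ht.trans (le_abs_self _)
    · filter_upwards [eventually_pos] with t ht using (Real.sq_sqrt ht.le).symm
  exact (h1.of_pow two_ne_zero).of_norm_left

theorem isBigO_inner {f g : ℝ → E} :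
    (fun t => ⟪f t, g t⟫_ℂ) =O[𝓝[>] 0] fun t => ‖f t‖ * ‖g t‖ :=
  IsBigO.of_bound 1 (Eventually.of_forall fun t => by
    simpa using norm_inner_le_norm (𝕜 := ℂ) (f t) (g t))

theorem eventually_sqrt_mul_sqrt :
    (fun t : ℝ => √t * √t) =ᶠ[𝓝[>] 0] fun t => t := by
  filter_upwards [eventually_pos] with t ht using Real.mul_self_sqrt ht.le

theorem Negligible.inner_left {f g : ℝ → E} (hf : Negligible f)
    (hg : g =O[𝓝[>] 0] fun t : ℝ => √t) :
    (fun t => ⟪f t, g t⟫_ℂ) =o[𝓝[>] 0] fun t : ℝ => t :=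
  isBigO_inner.trans_isLittleO
    ((hf.norm_left.mul_isBigO hg.norm_left).congr' EventuallyEq.rfl eventually_sqrt_mul_sqrt)

theorem Negligible.inner_right {f g : ℝ → E} (hf : f =O[𝓝[>] 0] fun t : ℝ => √t)
    (hg : Negligible g) :
    (fun t => ⟪f t, g t⟫_ℂ) =o[𝓝[>] 0] fun t : ℝ => t :=
  isBigO_inner.trans_isLittleO
    ((hf.norm_left.mul_isLittleO hg.norm_left).congr' EventuallyEq.rfl eventually_sqrt_mul_sqrt)

theorem tendsto_inv_mul_of_isLittleO {f : ℝ → ℂ} (hf : f =o[𝓝[>] 0] fun t : ℝ => t) :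
    Tendsto (fun t : ℝ => (t : ℂ)⁻¹ * f t) (𝓝[>] 0) (𝓝 0) := by
  have h1 : f =o[𝓝[>] 0] fun t : ℝ => (t : ℂ) :=
    hf.trans_isBigO (IsBigO.of_bound 1 (Eventually.of_forall fun t => by simp))
  refine h1.tendsto_div_nhds_zero.congr fun t => ?_
  rw [div_eq_inv_mul]

theorem isBigO_of_tendsto_inv_smul {F : Type*} [NormedAddCommGroup F] [NormedSpace ℂ F]
    {f : ℝ → F} {c : F} (hf : Tendsto (fun t : ℝ => (t : ℂ)⁻¹ • f t) (𝓝[>] 0) (𝓝 c)) :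
    f =O[𝓝[>] 0] fun t : ℝ => t := by
  have h1 : (fun t : ℝ => (t : ℂ) • ((t : ℂ)⁻¹ • f t)) =O[𝓝[>] 0] fun t : ℝ => (t : ℂ) • (1 : ℂ) :=
    (isBigO_refl _ _).smul (hf.isBigO_one ℂ)
  refine IsBigO.trans (h1.congr' ?_ EventuallyEq.rfl)
    (IsBigO.of_bound 1 (Eventually.of_forall fun t => by simp))
  filter_upwards [eventually_pos] with t ht
  rw [smul_smul, mul_inv_cancel₀ (by exact_mod_cast ht.ne'), one_smul]

theorem isLittleO_of_tendsto_inv_mul {f : ℝ → ℂ}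
    (hf : Tendsto (fun t : ℝ => (t : ℂ)⁻¹ * f t) (𝓝[>] 0) (𝓝 0)) :
    f =o[𝓝[>] 0] fun t : ℝ => t := by
  have h1 : (fun t : ℝ => (t : ℂ) * ((t : ℂ)⁻¹ * f t)) =o[𝓝[>] 0] fun t : ℝ => (t : ℂ) * (1 : ℂ) :=
    (isBigO_refl _ _).mul_isLittleO ((isLittleO_one_iff ℂ).2 hf)
  refine (h1.congr' ?_ EventuallyEq.rfl).trans_isBigO
    (IsBigO.of_bound 1 (Eventually.of_forall fun t => by simp))
  filter_upwards [eventually_pos] with t ht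
  rw [← mul_assoc, mul_inv_cancel₀ (by exact_mod_cast ht.ne'), one_mul]

/-- The limits `lim_{t ↓ 0} t⁻¹ ⟪f t, g t⟫` do not see negligible perturbations. -/
theorem tendsto_inner_of_negligible_sub {f f' g g' : ℝ → E} {c : ℂ}
    (hf : Negligible fun t => f t - f' t) (hg : Negligible fun t => g t - g' t)
    (hf' : f' =O[𝓝[>] 0] fun t : ℝ => √t) (hg' : g' =O[𝓝[>] 0] fun t : ℝ => √t)
    (hc : Tendsto (fun t : ℝ => (t : ℂ)⁻¹ * ⟪f' t, g' t⟫_ℂ) (𝓝[>] 0) (𝓝 c)) :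
    Tendsto (fun t : ℝ => (t : ℂ)⁻¹ * ⟪f t, g t⟫_ℂ) (𝓝[>] 0) (𝓝 c) := by
  have hgO : g =O[𝓝[>] 0] fun t : ℝ => √t := by
    simpa using (hg.isBigO.add hg')
  have := ((tendsto_inv_mul_of_isLittleO (hf.inner_left hgO)).add
    (tendsto_inv_mul_of_isLittleO (Negligible.inner_right hf' hg))).add hc
  simp only [zero_add] at this
  refine this.congr fun t => ?_
  simp only [inner_sub_left, inner_sub_right]
  ring

end Negligible

/-! ### Partial traces of rank one operators -/

/-- Bessel's inequality: with `P` the partial sum of the components of `a` along the `ζ_j`, both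
`⟪a, P⟫` and `‖P‖ ^ 2` equal the partial sum of squares, and `0 ≤ ‖a - P‖ ^ 2`. -/
theorem summable_norm_adjoint_tensorRight_sq (a : HTensor h H) :
    Summable fun j => ‖ContinuousLinearMap.adjoint (tensorRight (onb H j)) a‖ ^ 2 := by
  classical
  refine summable_of_sum_le (c := ‖a‖ ^ 2) (fun _ => by positivity) fun s => ?_
  set r : basisSet H → h := fun j => ContinuousLinearMap.adjoint (tensorRight (onb H j)) a
  set P : HTensor h H := ∑ j ∈ s, tensorRight (onb H j) (r j) with hP
  have h1 : ⟪a, P⟫_ℂ = ((∑ j ∈ s, ‖r j‖ ^ 2 : ℝ) : ℂ) := by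
    rw [hP, inner_sum, Complex.ofReal_sum]
    refine Finset.sum_congr rfl fun j _ => ?_
    rw [← ContinuousLinearMap.adjoint_inner_left, inner_self_eq_norm_sq_to_K]
    norm_cast
  have h2 : ⟪P, P⟫_ℂ = ((∑ j ∈ s, ‖r j‖ ^ 2 : ℝ) : ℂ) := by
    rw [hP, sum_inner, Complex.ofReal_sum]
    refine Finset.sum_congr rfl fun i hi => ?_
    rw [inner_sum, Finset.sum_eq_single_of_mem i hi fun j _ hj => ?_]
    · rw [tensorRight_apply, inner_tensorLeft, inner_self_eq_norm_sq_to_K,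
        inner_self_eq_norm_sq_to_K, (onb H).orthonormal.1 i]
      norm_cast
      simp
    · rw [tensorRight_apply, tensorRight_apply, inner_tensorLeft,
        (onb H).orthonormal.2 hj.symm, mul_zero]
  have h3 : ‖P‖ ^ 2 = ∑ j ∈ s, ‖r j‖ ^ 2 := by
    apply Complex.ofReal_injective
    rw [← h2, inner_self_eq_norm_sq_to_K]
    norm_cast
  have h4 := norm_sub_sq (𝕜 := ℂ) a P
  rw [h1, h3, RCLike.re_to_complex, Complex.ofReal_re] at h4
  nlinarith [sq_nonneg ‖a - P‖]

theorem adjoint_comp_rankOne_comp {E F : Type*} [NormedAddCommGroup E] [InnerProductSpace ℂ E]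
    [CompleteSpace E] [NormedAddCommGroup F] [InnerProductSpace ℂ F] [CompleteSpace F]
    (R : E →L[ℂ] F) (a b : F) :
    ContinuousLinearMap.adjoint R ∘L InnerProductSpace.rankOne ℂ a b ∘L R =
      InnerProductSpace.rankOne ℂ (ContinuousLinearMap.adjoint R a)
        (ContinuousLinearMap.adjoint R b) := by
  ext1 z
  simp [ContinuousLinearMap.adjoint_inner_left]

/-- The operators in the series have norm `‖a_j‖ * ‖b_j‖ ≤ ‖a_j‖ ^ 2 + ‖b_j‖ ^ 2`, so the `tsum` is
a genuine sum and not the default value `0`. Its matrix elements are then evaluated by Parseval's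
identity in `H`. -/
theorem inner_partialTrace_rankOne (a b : HTensor h H) (x y : h) :
    ⟪x, partialTrace (InnerProductSpace.rankOne ℂ a b) y⟫_ℂ =
      ⟪ContinuousLinearMap.adjoint (tensorLeft y) b,
        ContinuousLinearMap.adjoint (tensorLeft x) a⟫_ℂ := by
  have hs : Summable fun j => InnerProductSpace.rankOne ℂ
      (ContinuousLinearMap.adjoint (tensorRight (h := h) (onb H j)) a)
      (ContinuousLinearMap.adjoint (tensorRight (h := h) (onb H j)) b) := by
    refine Summable.of_norm_bounded ((summable_norm_adjoint_tensorRight_sq a).add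
      (summable_norm_adjoint_tensorRight_sq b)) fun j => ?_
    rw [InnerProductSpace.norm_rankOne]
    nlinarith [two_mul_le_add_sq
      ‖ContinuousLinearMap.adjoint (tensorRight (h := h) (onb H j)) a‖
      ‖ContinuousLinearMap.adjoint (tensorRight (h := h) (onb H j)) b‖,
      norm_nonneg (ContinuousLinearMap.adjoint (tensorRight (h := h) (onb H j)) a),
      norm_nonneg (ContinuousLinearMap.adjoint (tensorRight (h := h) (onb H j)) b),
      sq_nonneg ‖ContinuousLinearMap.adjoint (tensorRight (h := h) (onb H j)) a‖,
      sq_nonneg ‖ContinuousLinearMap.adjoint (tensorRight (h := h) (onb H j)) b‖]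
  have h1 := ((hs.hasSum.mapL (ContinuousLinearMap.apply ℂ h y)).mapL (innerSL ℂ x))
  have h2 := (onb H).hasSum_inner_mul_inner
    (ContinuousLinearMap.adjoint (tensorLeft y) b) (ContinuousLinearMap.adjoint (tensorLeft x) a)
  simp only [partialTrace, adjoint_comp_rankOne_comp]
  refine h1.unique ?_
  convert h2 using 2 with j
  simp [ContinuousLinearMap.adjoint_inner_left, ContinuousLinearMap.adjoint_inner_right,
    tensorRight_apply]

theorem tensorOp_rankOne (x y : h) (ξ ζ : H) :
    tensorOp (InnerProductSpace.rankOne ℂ x y) (InnerProductSpace.rankOne ℂ ξ ζ) =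
      InnerProductSpace.rankOne ℂ (tensorLeft x ξ : HTensor h H) (tensorLeft y ζ) := by
  ext1 z
  induction z using UniformSpace.Completion.induction_on with
  | hp => exact isClosed_eq (ContinuousLinearMap.continuous _) (ContinuousLinearMap.continuous _)
  | ih z =>
    rw [tensorOp, ContinuousLinearMap.completion_apply_coe, InnerProductSpace.rankOne_apply,
      tensorLeft_apply, tensorLeft_apply, UniformSpace.Completion.inner_coe,
      ← UniformSpace.Completion.coe_smul]
    congr 1
    induction z using TensorProduct.induction_on with
    | zero => simp
    | tmul z z' =>
      simp [TensorProduct.inner_tmul, TensorProduct.smul_tmul', TensorProduct.tmul_smul, smul_smul,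
        mul_comm]
    | add z z' hz hz' => rw [map_add, hz, hz', inner_add_right, add_smul]

theorem comp_rankOne_comp_adjoint {E : Type*} [NormedAddCommGroup E] [InnerProductSpace ℂ E]
    [CompleteSpace E] (V : E →L[ℂ] E) (a b : E) :
    V ∘L InnerProductSpace.rankOne ℂ a b ∘L ContinuousLinearMap.adjoint V =
      InnerProductSpace.rankOne ℂ (V a) (V b) := by
  ext1 z
  simp [ContinuousLinearMap.adjoint_inner_right]

variable {U : ℝ → ℝ → HTensor h H →L[ℂ] HTensor h H} {Ω : H}

/-- The link between the hypothesis on `𝒟(ℒ)` and the kernel: `Z_t` on rank one operators encodes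
the inner products of the vectors `U_t(x, y) Ω`. -/
theorem inner_semiZ_rankOne (t : ℝ) (x y p q : h) :
    ⟪p, semiZ U Ω t (InnerProductSpace.rankOne ℂ x y) q⟫_ℂ =
      ⟪matEl (U 0 t) q y Ω, matEl (U 0 t) p x Ω⟫_ℂ := by
  rw [semiZ, tensorOp_rankOne, comp_rankOne_comp_adjoint, inner_partialTrace_rankOne]
  rfl

theorem inner_semiT (t : ℝ) (x y : h) :
    ⟪x, semiT U Ω t y⟫_ℂ = ⟪Ω, matEl (U 0 t) x y Ω⟫_ℂ := by
  rw [semiT, ContinuousLinearMap.comp_apply, ContinuousLinearMap.adjoint_inner_right, inner_matEl]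
  rfl

/-- Orthonormal systems with one vector take part in the supremum. -/
theorem enorm_inner_le_traceNorm (ρ : h →L[ℂ] h) {x y : h} (hx : ‖x‖ = 1) (hy : ‖y‖ = 1) :
    ‖⟪x, ρ y⟫_ℂ‖ₑ ≤ traceNorm ρ := by
  have key {z : h} (hz : ‖z‖ = 1) : Orthonormal ℂ fun _ : Fin 1 => z :=
    ⟨fun _ => hz, fun i j hij => (hij (Subsingleton.elim i j)).elim⟩
  refine le_trans ?_ (le_iSup₂_of_le 1 (fun _ => x) <| le_iSup₂_of_le (fun _ => y) (key hx) <|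
    le_iSup_of_le (key hy) le_rfl)
  simp

/-- Convergence in trace norm implies weak convergence. -/
theorem tendsto_inner_of_tendsto_traceNorm {ι : Type*} {l : Filter ι} {ρ : ι → h →L[ℂ] h}
    {σ : h →L[ℂ] h} (hρ : Tendsto (fun i => traceNorm (ρ i - σ)) l (𝓝 0)) (x y : h) :
    Tendsto (fun i => ⟪x, ρ i y⟫_ℂ) l (𝓝 ⟪x, σ y⟫_ℂ) := by
  have unit (a b : h) (ha : ‖a‖ = 1) (hb : ‖b‖ = 1) :
      Tendsto (fun i => ⟪a, ρ i b⟫_ℂ) l (𝓝 ⟪a, σ b⟫_ℂ) := by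
    rw [tendsto_iff_edist_tendsto_0]
    refine tendsto_of_tendsto_of_tendsto_of_le_of_le tendsto_const_nhds hρ (fun _ => zero_le)
      fun i => ?_
    rw [edist_eq_enorm_sub, ← inner_sub_right]
    exact enorm_inner_le_traceNorm (ρ i - σ) ha hb
  rcases eq_or_ne x 0 with rfl | hx
  · simpa using tendsto_const_nhds
  rcases eq_or_ne y 0 with rfl | hy
  · simpa using tendsto_const_nhds
  have hx' : ‖x‖ ≠ 0 := norm_ne_zero_iff.2 hx
  have hy' : ‖y‖ ≠ 0 := norm_ne_zero_iff.2 hy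
  have h1 := unit ((‖x‖ : ℂ)⁻¹ • x) ((‖y‖ : ℂ)⁻¹ • y) (by simp [norm_smul, hx'])
    (by simp [norm_smul, hy'])
  have h2 := h1.const_mul ((‖x‖ : ℂ) * ‖y‖)
  simp only [map_smul, inner_smul_left, inner_smul_right, map_inv₀, Complex.conj_ofReal] at h2
  have e (z : ℂ) : (‖x‖ : ℂ) * ‖y‖ * ((‖y‖ : ℂ)⁻¹ * ((‖x‖ : ℂ)⁻¹ * z)) = z := by
    have : (‖x‖ : ℂ) ≠ 0 := by exact_mod_cast hx'
    have : (‖y‖ : ℂ) ≠ 0 := by exact_mod_cast hy'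
    field_simp
  simpa only [e] using h2

/-! ### Increments of the process -/

/-- The matrix element `(U_t^(ε) - 1)(x, y)`. -/
def incr (U : ℝ → ℝ → HTensor h H →L[ℂ] HTensor h H) (t : ℝ) (ε : ZMod 2) (x y : h) : H →L[ℂ] H :=
  matEl (epsOp ε (U 0 t) - 1) x y

theorem IsUnitaryIncrementProcess.eventually_mem_unitary (hA : IsUnitaryIncrementProcess U Ω) :
    ∀ᶠ t : ℝ in 𝓝[>] 0, ∀ ε, epsOp ε (U 0 t) ∈ unitary (HTensor h H →L[ℂ] HTensor h H) := by
  filter_upwards [eventually_pos] with t ht ε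
  exact epsOp_mem_unitary (hA.unitary_mem 0 t le_rfl ht.le) ε

theorem inner_incr_left (t : ℝ) (ε : ZMod 2) (x y : h) (ξ ζ : H) :
    ⟪incr U t ε x y ξ, ζ⟫_ℂ = ⟪ξ, incr U t (ε + 1) y x ζ⟫_ℂ :=
  inner_matEl_epsOp_sub_one _ _ _ _ _ _

theorem incr_isBigO (hA : IsUnitaryIncrementProcess U Ω) (ε : ZMod 2) (x y : h) (f : ℝ → H) :
    (fun t => incr U t ε x y (f t)) =O[𝓝[>] 0] f := by
  refine IsBigO.of_bound (2 * ‖x‖ * ‖y‖) ?_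
  filter_upwards [hA.eventually_mem_unitary] with t ht
  exact norm_matEl_sub_one_le (ht ε) x y (f t)

theorem Negligible.incr (hA : IsUnitaryIncrementProcess U Ω) {f : ℝ → H} (hf : Negligible f)
    (ε : ZMod 2) (x y : h) : Negligible fun t => incr U t ε x y (f t) :=
  (incr_isBigO hA ε x y f).trans_isLittleO hf

/-- If `⟪f t, (U_t^(ε) - 1)(y, y) f t⟫ = o(t)` then `(U_t^(ε) - 1)(x, y) f t = o(√t)`. -/
theorem negligible_incr_of_inner (hA : IsUnitaryIncrementProcess U Ω) {f : ℝ → H} {ε : ZMod 2}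
    {y : h} (hf : (fun t => ⟪f t, incr U t ε y y (f t)⟫_ℂ) =o[𝓝[>] 0] fun t : ℝ => t) (x : h) :
    Negligible fun t => NoiseSpace.incr U t ε x y (f t) := by
  refine negligible_of_sq_le
    (g := fun t => ‖x‖ ^ 2 * (-2 * (⟪f t, NoiseSpace.incr U t ε y y (f t)⟫_ℂ).re)) ?_ ?_
  · filter_upwards [hA.eventually_mem_unitary] with t ht
    exact norm_matEl_sub_one_sq_le (ht ε) x y (f t)
  · refine IsLittleO.const_mul_left (IsLittleO.const_mul_left ?_ _) _
    exact (IsBigO.of_bound 1 (Eventually.of_forall fun t => by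
      simpa using Complex.abs_re_le_norm _)).trans_isLittleO hf

theorem IsGaussian.isLittleO_incr (hC : IsGaussian U Ω) (x y : Fin 3 → h) (ε : Fin 3 → ZMod 2) :
    (fun t => ⟪Ω, incr U t (ε 0) (x 0) (y 0) (incr U t (ε 1) (x 1) (y 1)
      (incr U t (ε 2) (x 2) (y 2) Ω))⟫_ℂ) =o[𝓝[>] 0] fun t : ℝ => t :=
  isLittleO_of_tendsto_inv_mul (hC x y ε)

/-- The squared norm is bounded by a diagonal expectation in the vector `incr U t ε' x' y' Ω`.
Moving the left copy of that increment across gives three increments between two vacua, the first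
one being at `(y', x')` with `ε' + 1`. No domain condition on the vectors is needed. -/
theorem negligible_incr_incr (hA : IsUnitaryIncrementProcess U Ω) (hC : IsGaussian U Ω)
    (ε ε' : ZMod 2) (x y x' y' : h) :
    Negligible fun t => incr U t ε x y (incr U t ε' x' y' Ω) := by
  refine negligible_incr_of_inner hA ?_ x
  simp only [inner_incr_left]
  exact hC.isLittleO_incr ![y', y, x'] ![x', y, y'] ![ε' + 1, ε, ε']

theorem inner_incr_zero (hA : IsUnitaryIncrementProcess U Ω) (t : ℝ) (x y : h) :
    ⟪Ω, incr U t 0 x y Ω⟫_ℂ = ⟪x, semiT U Ω t y - y⟫_ℂ := by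
  simp [incr, epsOp_zero, matEl_sub_one, inner_semiT, hA.norm_vacuum]

/-- For `ε = 1` the diagonal expectation is the complex conjugate of the one for `ε = 0`, so its
real part is the same and `T_t` controls both. -/
theorem norm_incr_vacuum_sq_le (hA : IsUnitaryIncrementProcess U Ω) {t : ℝ} (ht : 0 < t)
    (ε : ZMod 2) (x y : h) :
    ‖incr U t ε x y Ω‖ ^ 2 ≤ ‖x‖ ^ 2 * (2 * (‖y‖ * ‖semiT U Ω t y - y‖)) := by
  have h1 : (⟪Ω, incr U t ε y y Ω⟫_ℂ).re = (⟪y, semiT U Ω t y - y⟫_ℂ).re := by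
    obtain rfl | rfl : ε = 0 ∨ ε = 1 := by revert ε; decide
    · rw [inner_incr_zero hA]
    · rw [← inner_incr_zero hA, show (1 : ZMod 2) = 0 + 1 from rfl, ← inner_incr_left]
      exact inner_re_symm (𝕜 := ℂ) _ _
  refine (norm_matEl_sub_one_sq_le
    (epsOp_mem_unitary (hA.unitary_mem 0 t le_rfl ht.le) ε) x y Ω).trans ?_
  change ‖x‖ ^ 2 * (-2 * (⟪Ω, incr U t ε y y Ω⟫_ℂ).re) ≤ _
  rw [h1]
  have h2 := (Complex.abs_re_le_norm ⟪y, semiT U Ω t y - y⟫_ℂ).trans (norm_inner_le_norm _ _)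
  refine mul_le_mul_of_nonneg_left ?_ (by positivity)
  linarith [neg_abs_le (⟪y, semiT U Ω t y - y⟫_ℂ).re]

theorem isBigO_semiT_sub {y : h} (hy : y ∈ domG U Ω) :
    (fun t => semiT U Ω t y - y) =O[𝓝[>] 0] fun t : ℝ => t :=
  let ⟨_, hg⟩ := hy
  isBigO_of_tendsto_inv_smul hg

theorem incr_vacuum_isBigO (hA : IsUnitaryIncrementProcess U Ω) (ε : ZMod 2) (x : h) {y : h}
    (hy : y ∈ domG U Ω) : (fun t => incr U t ε x y Ω) =O[𝓝[>] 0] fun t : ℝ => √t := by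
  refine isBigO_sqrt_of_sq_le (g := fun t => ‖x‖ ^ 2 * (2 * (‖y‖ * ‖semiT U Ω t y - y‖))) ?_ ?_
  · filter_upwards [eventually_pos] with t ht using norm_incr_vacuum_sq_le hA ht ε x y
  · exact (((isBigO_semiT_sub hy).norm_left.const_mul_left _).const_mul_left _).const_mul_left _

/-- `(U_t^* - 1) + (U_t - 1) = -(U_t - 1)^* (U_t - 1)` in weak form. -/
theorem inner_matEl_sub_one_add_adjoint {V : HTensor h H →L[ℂ] HTensor h H}
    (hV : V ∈ unitary (HTensor h H →L[ℂ] HTensor h H)) (x y : h) (ξ ζ : H) :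
    ⟪ξ, matEl (V - 1) x y ζ + matEl (ContinuousLinearMap.adjoint V - 1) x y ζ⟫_ℂ =
      -⟪(V - 1) (tensorLeft x ξ), (V - 1) (tensorLeft y ζ)⟫_ℂ := by
  have h1 : ⟪V (tensorLeft x ξ), V (tensorLeft y ζ)⟫_ℂ =
      ⟪(tensorLeft x ξ : HTensor h H), tensorLeft y ζ⟫_ℂ :=
    ContinuousLinearMap.inner_map_map_of_mem_unitary hV _ _
  simp only [inner_add_right, inner_matEl, sub_apply, one_apply_eq_self, inner_sub_left,
    inner_sub_right, ContinuousLinearMap.adjoint_inner_right, h1]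
  ring

/-- With `S` the sum, unitarity gives `‖S‖ ^ 2 = |⟪(U_t - 1)(x ⊗ S), (U_t - 1)(y ⊗ Ω)⟫|`. The first
vector is `o(√t)` by the Gaussian condition, the second is `O(√t)` because `y ∈ 𝒟(G)`. -/
theorem negligible_incr_add_incr (hA : IsUnitaryIncrementProcess U Ω) (hC : IsGaussian U Ω)
    (x : h) {y : h} (hy : y ∈ domG U Ω) :
    Negligible fun t => incr U t 0 x y Ω + incr U t 1 x y Ω := by
  set S : ℝ → H := fun t => incr U t 0 x y Ω + incr U t 1 x y Ω with hS
  have h1 : Negligible fun t => (U 0 t - 1) (tensorLeft x (S t)) := by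
    refine negligible_of_sq_le (g := fun t => -2 * (⟪S t, incr U t 0 x x (S t)⟫_ℂ).re) ?_ ?_
    · filter_upwards [eventually_pos] with t ht
      rw [incr, inner_matEl, epsOp_zero]
      exact (norm_unitary_sub_one_sq (hA.unitary_mem 0 t le_rfl ht.le) _).le
    · refine IsLittleO.const_mul_left ?_ _
      -- Expanding both copies of `S` gives four terms, each a vacuum expectation of three
      -- increments.
      have h2 (ε ε' : ZMod 2) : (fun t => ⟪incr U t ε x y Ω,
          incr U t 0 x x (incr U t ε' x y Ω)⟫_ℂ) =o[𝓝[>] 0] fun t : ℝ => t := by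
        simp only [inner_incr_left]
        exact hC.isLittleO_incr ![y, x, x] ![x, x, y] ![ε + 1, 0, ε']
      have h3 : (fun t => ⟪S t, incr U t 0 x x (S t)⟫_ℂ) =o[𝓝[>] 0] fun t : ℝ => t := by
        simp only [hS, map_add, inner_add_left, inner_add_right]
        exact ((h2 0 0).add (h2 1 0)).add ((h2 0 1).add (h2 1 1))
      exact (IsBigO.of_bound 1 (Eventually.of_forall fun t => by
        simpa using Complex.abs_re_le_norm _)).trans_isLittleO h3
  have h2 : (fun t => (U 0 t - 1) (tensorLeft y Ω)) =O[𝓝[>] 0] fun t : ℝ => √t := by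
    refine isBigO_sqrt_of_sq_le (g := fun t => 2 * (‖y‖ * ‖semiT U Ω t y - y‖)) ?_ ?_
    · filter_upwards [eventually_pos] with t ht
      rw [norm_unitary_sub_one_sq (hA.unitary_mem 0 t le_rfl ht.le), ← inner_matEl]
      have h3 := inner_incr_zero hA t y y
      rw [incr, epsOp_zero] at h3
      rw [h3]
      have h2 := (Complex.abs_re_le_norm ⟪y, semiT U Ω t y - y⟫_ℂ).trans (norm_inner_le_norm _ _)
      linarith [neg_abs_le (⟪y, semiT U Ω t y - y⟫_ℂ).re]
    · exact ((isBigO_semiT_sub hy).norm_left.const_mul_left _).const_mul_left _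
  refine negligible_of_sq_le (g := fun t => ‖⟪(U 0 t - 1) (tensorLeft x (S t)),
    (U 0 t - 1) (tensorLeft y Ω)⟫_ℂ‖) ?_ (h1.inner_left h2).norm_left
  filter_upwards [eventually_pos] with t ht
  have h3 := inner_matEl_sub_one_add_adjoint (hA.unitary_mem 0 t le_rfl ht.le) x y (S t) Ω
  rw [← norm_neg ⟪(U 0 t - 1) (tensorLeft x (S t)), _⟫_ℂ, ← h3]
  have h4 : S t = matEl (U 0 t - 1) x y Ω + matEl (ContinuousLinearMap.adjoint (U 0 t) - 1) x y Ω := by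
    simp only [hS, incr, epsOp_zero, epsOp_one]
  rw [← h4, inner_self_eq_norm_sq_to_K]
  simp

/-- With `ρ = |q⟩⟨y|`, the inner product equals `⟪p, (Z_t ρ - ρ) x⟫ - conj ⟪x, T_t y - y⟫ * ⟪p, q⟫ -
conj ⟪x, y⟫ * ⟪p, T_t q - q⟫`, and each term divided by `t` converges. -/
theorem tendsto_inner_incr_zero (hA : IsUnitaryIncrementProcess U Ω)
    (hN : (spaceN U Ω : Set (h →L[ℂ] h)) ⊆ domL U Ω) (x p : h) {y q : h}
    (hy : y ∈ domG U Ω) (hq : q ∈ domG U Ω) :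
    ∃ c, Tendsto (fun t : ℝ => (t : ℂ)⁻¹ * ⟪incr U t 0 x y Ω, incr U t 0 p q Ω⟫_ℂ)
      (𝓝[>] 0) (𝓝 c) := by
  obtain ⟨-, σ, -, hσ⟩ :=
    hN (Submodule.subset_span ⟨q, hq, y, hy, rfl⟩ : InnerProductSpace.rankOne ℂ q y ∈ spaceN U Ω)
  obtain ⟨g, hg⟩ := hy
  obtain ⟨g', hg'⟩ := hq
  have h1 := tendsto_inner_of_tendsto_traceNorm hσ p x
  have h2 := ((tendsto_const_nhds (x := x)).inner hg).star.mul_const ⟪p, q⟫_ℂ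
  have h3 := ((tendsto_const_nhds (x := p)).inner hg').const_mul (star ⟪x, y⟫_ℂ)
  refine ⟨_, ((h1.sub h2).sub h3).congr fun t => ?_⟩
  have hΩ := inner_self_eq_norm_sq_to_K (𝕜 := ℂ) Ω
  rw [hA.norm_vacuum] at hΩ
  have e1 : ⟪matEl (U 0 t) x y Ω, Ω⟫_ℂ = star ⟪x, semiT U Ω t y⟫_ℂ := by
    rw [inner_semiT]
    exact (inner_conj_symm _ _).symm
  have e2 := inner_semiT (U := U) (Ω := Ω) t p q
  have e3 := inner_semiZ_rankOne (U := U) (Ω := Ω) t q y p x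
  have e4 : ⟪y, x⟫_ℂ = star ⟪x, y⟫_ℂ := (inner_conj_symm _ _).symm
  simp only [incr, epsOp_zero, matEl_sub_one, sub_apply, smul_apply, one_apply_eq_self,
    inner_sub_left, inner_sub_right, inner_smul_left, inner_smul_right, ← e2, ← e3, e1, hΩ,
    InnerProductSpace.rankOne_apply, e4, star_mul', star_sub, Complex.star_def, map_inv₀,
    Complex.conj_ofReal]
  simp
  ring

theorem tendsto_inner_incr (hA : IsUnitaryIncrementProcess U Ω) (hC : IsGaussian U Ω)
    (hN : (spaceN U Ω : Set (h →L[ℂ] h)) ⊆ domL U Ω) (x p : h) {y q : h} (ε δ : ZMod 2)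
    (hy : y ∈ domG U Ω) (hq : q ∈ domG U Ω) :
    ∃ c, Tendsto (fun t : ℝ => (t : ℂ)⁻¹ * ⟪incr U t ε x y Ω, incr U t δ p q Ω⟫_ℂ)
      (𝓝[>] 0) (𝓝 c) := by
  -- Modulo negligible vectors the increment for `ε` is `s = ±1` times the one for `ε = 0`.
  have sgn (ε : ZMod 2) : ∃ s : ℂ, ∀ (x : h) {y : h}, y ∈ domG U Ω →
      Negligible fun t => incr U t ε x y Ω - s • incr U t 0 x y Ω := by
    obtain rfl | rfl : ε = 0 ∨ ε = 1 := by revert ε; decide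
    · exact ⟨1, fun x y hy => by simp [Negligible]⟩
    · refine ⟨-1, fun x y hy => ?_⟩
      simpa [add_comm] using negligible_incr_add_incr hA hC x hy
  obtain ⟨s, hs⟩ := sgn ε
  obtain ⟨s', hs'⟩ := sgn δ
  obtain ⟨c, hc⟩ := tendsto_inner_incr_zero hA hN x p hy hq
  refine ⟨star s * s' * c, tendsto_inner_of_negligible_sub (hs x hy) (hs' p hq)
    ((incr_vacuum_isBigO hA 0 x hy).const_smul_left s)
    ((incr_vacuum_isBigO hA 0 p hq).const_smul_left s')
    ((hc.const_mul (star s * s')).congr fun t => ?_)⟩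
  simp only [inner_smul_left, inner_smul_right, Complex.star_def]
  ring

/-! ### Words of increments -/

theorem prodInner_succ {n : ℕ} (x y : Fin (n + 1) → h) :
    prodInner x y = ⟪x 0, y 0⟫_ℂ * prodInner (fun i => x i.succ) fun i => y i.succ :=
  Fin.prod_univ_succ _

theorem prodInner_append {n m : ℕ} (x y : Fin n → h) (p q : Fin m → h) :
    prodInner (Fin.append x p) (Fin.append y q) = prodInner x y * prodInner p q := by
  simp [prodInner, Fin.prod_univ_add]

theorem wordOp_succ {n : ℕ} (s t : Fin (n + 1) → ℝ) (ε : Fin (n + 1) → ZMod 2)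
    (x y : Fin (n + 1) → h) :
    wordOp U s t ε x y = matEl (epsOp (ε 0) (U (s 0) (t 0))) (x 0) (y 0) *
      wordOp U (fun i => s i.succ) (fun i => t i.succ) (fun i => ε i.succ) (fun i => x i.succ)
        fun i => y i.succ := by
  rw [wordOp, List.ofFn_succ, List.prod_cons]
  rfl

theorem wordOp_append (t : ℝ) {n m : ℕ} (ε : Fin n → ZMod 2) (δ : Fin m → ZMod 2)
    (x y : Fin n → h) (p q : Fin m → h) :
    wordOp U (fun _ => 0) (fun _ => t) (Fin.append ε δ) (Fin.append x p) (Fin.append y q) =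
      wordOp U (fun _ => 0) (fun _ => t) ε x y * wordOp U (fun _ => 0) (fun _ => t) δ p q := by
  rw [wordOp, wordOp, wordOp, ← List.prod_append, ← List.ofFn_fin_append]
  congr 2
  funext i
  refine Fin.addCases (fun j => ?_) (fun j => ?_) i <;> simp

theorem matEl_epsOp (t : ℝ) (ε : ZMod 2) (x y : h) :
    matEl (epsOp ε (U 0 t)) x y = incr U t ε x y + ⟪x, y⟫_ℂ • (1 : H →L[ℂ] H) := by
  rw [incr, matEl_sub_one, sub_add_cancel]

theorem wordDiff_zero (t : ℝ) (ε : Fin 0 → ZMod 2) (x y : Fin 0 → h) :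
    wordDiff U t ε x y = 0 := by
  simp [wordDiff, wordOp, prodInner]

/-- This is `A B - α β = (A - α)(B - β) + α (B - β) + β (A - α)`. On `Ω` the first term is
negligible, and the other two form the Leibniz rule. -/
theorem wordDiff_succ_apply (t : ℝ) {n : ℕ} (ε : Fin (n + 1) → ZMod 2) (x y : Fin (n + 1) → h)
    (ξ : H) :
    wordDiff U t ε x y ξ = incr U t (ε 0) (x 0) (y 0)
        (wordDiff U t (fun i => ε i.succ) (fun i => x i.succ) (fun i => y i.succ) ξ) +
      ⟪x 0, y 0⟫_ℂ • wordDiff U t (fun i => ε i.succ) (fun i => x i.succ) (fun i => y i.succ) ξ +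
      prodInner (fun i => x i.succ) (fun i => y i.succ) • incr U t (ε 0) (x 0) (y 0) ξ := by
  rw [wordDiff, wordDiff, wordOp_succ, matEl_epsOp, prodInner_succ]
  simp only [sub_apply, smul_apply, one_apply_eq_self, mul_apply_eq_comp, add_apply,
    map_sub, map_smul, smul_sub, smul_smul]
  abel

theorem wordDiff_append_apply (t : ℝ) {n m : ℕ} (ε : Fin n → ZMod 2) (δ : Fin m → ZMod 2)
    (x y : Fin n → h) (p q : Fin m → h) (ξ : H) :
    wordDiff U t (Fin.append ε δ) (Fin.append x p) (Fin.append y q) ξ =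
      wordDiff U t ε x y (wordDiff U t δ p q ξ) + prodInner p q • wordDiff U t ε x y ξ +
        prodInner x y • wordDiff U t δ p q ξ := by
  simp only [wordDiff, wordOp_append, prodInner_append, sub_apply, smul_apply, one_apply_eq_self,
    mul_apply_eq_comp, map_sub, map_smul, smul_sub, smul_smul,
    mul_comm (prodInner p q)]
  abel

theorem Negligible.add {f g : ℝ → H} (hf : Negligible f) (hg : Negligible g) :
    Negligible fun t => f t + g t :=
  IsLittleO.add hf hg

theorem Negligible.const_smul {f : ℝ → H} (hf : Negligible f) (c : ℂ) :
    Negligible fun t => c • f t :=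
  IsLittleO.const_smul_left hf c

theorem negligible_zero : Negligible fun _ : ℝ => (0 : H) :=
  isLittleO_zero _ _

/-- A word minus its scalar part has no constant term: every summand of its expansion has an
increment acting directly on `f t`, and further increments are bounded. -/
theorem negligible_wordDiff (hA : IsUnitaryIncrementProcess U Ω) {f : ℝ → H}
    (hf : ∀ ε x y, Negligible fun t => incr U t ε x y (f t)) {n : ℕ} (ε : Fin n → ZMod 2)
    (x y : Fin n → h) : Negligible fun t => wordDiff U t ε x y (f t) := by
  induction n with
  | zero => simpa [wordDiff_zero] using negligible_zero
  | succ n ih =>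
    simp only [wordDiff_succ_apply]
    have h1 := ih (fun i => ε i.succ) (fun i => x i.succ) (fun i => y i.succ)
    exact ((h1.incr hA _ _ _).add (h1.const_smul _)).add ((hf _ _ _).const_smul _)

theorem negligible_incr_wordDiff (hA : IsUnitaryIncrementProcess U Ω) (hC : IsGaussian U Ω) {n : ℕ}
    (ε : Fin n → ZMod 2) (x y : Fin n → h) (δ : ZMod 2) (p q : h) :
    Negligible fun t => incr U t δ p q (wordDiff U t ε x y Ω) := by
  induction n generalizing δ p q with
  | zero => simpa [wordDiff_zero] using negligible_zero
  | succ n ih =>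
    simp only [wordDiff_succ_apply, map_add, map_smul]
    have h1 := ih (fun i => ε i.succ) (fun i => x i.succ) (fun i => y i.succ)
    exact (((h1 _ _ _).incr hA _ _ _).add ((h1 _ _ _).const_smul _)).add
      ((negligible_incr_incr hA hC _ _ _ _ _ _).const_smul _)

theorem negligible_wordDiff_append_sub (hA : IsUnitaryIncrementProcess U Ω) (hC : IsGaussian U Ω)
    {n m : ℕ} (ε : Fin n → ZMod 2) (δ : Fin m → ZMod 2) (x y : Fin n → h) (p q : Fin m → h) :
    Negligible fun t => wordDiff U t (Fin.append ε δ) (Fin.append x p) (Fin.append y q) Ω -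
      prodInner p q • wordDiff U t ε x y Ω - prodInner x y • wordDiff U t δ p q Ω := by
  refine (negligible_wordDiff hA (negligible_incr_wordDiff hA hC δ p q) ε x y).congr_left fun t => ?_
  rw [wordDiff_append_apply]
  abel

theorem prod_erase_succ {n : ℕ} (c : Fin (n + 1) → ℂ) (i : Fin n) :
    ∏ j ∈ Finset.univ.erase i.succ, c j = c 0 * ∏ j ∈ Finset.univ.erase i, c j.succ := by
  have h1 {m : ℕ} (i : Fin m) (c : Fin m → ℂ) :
      ∏ j ∈ Finset.univ.erase i, c j = ∏ j, if j = i then 1 else c j := by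
    rw [← Finset.mul_prod_erase _ _ (Finset.mem_univ i), if_pos rfl, one_mul]
    exact Finset.prod_congr rfl fun j hj => (if_neg (Finset.ne_of_mem_erase hj)).symm
  rw [h1, h1, Fin.prod_univ_succ, if_neg (Fin.succ_ne_zero i).symm]
  simp [Fin.succ_inj]

theorem prod_erase_zero {n : ℕ} (c : Fin (n + 1) → ℂ) :
    ∏ j ∈ Finset.univ.erase 0, c j = ∏ j : Fin n, c j.succ := by
  rw [Fin.univ_succ, Finset.erase_cons, Finset.prod_map]
  rfl

/-- Induction on the length by the Leibniz rule; each step discards one product of an increment with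
a shorter word, negligible on `Ω`. -/
theorem negligible_wordDiff_sub_sum (hA : IsUnitaryIncrementProcess U Ω) (hC : IsGaussian U Ω)
    {n : ℕ} (ε : Fin n → ZMod 2) (x y : Fin n → h) :
    Negligible fun t => wordDiff U t ε x y Ω -
      ∑ i, (∏ j ∈ Finset.univ.erase i, ⟪x j, y j⟫_ℂ) • incr U t (ε i) (x i) (y i) Ω := by
  induction n with
  | zero => simpa [wordDiff_zero] using negligible_zero
  | succ n ih =>
    have h1 := ih (fun i => ε i.succ) (fun i => x i.succ) (fun i => y i.succ)
    refine ((negligible_incr_wordDiff hA hC (fun i => ε i.succ) (fun i => x i.succ)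
      (fun i => y i.succ) (ε 0) (x 0) (y 0)).add (h1.const_smul ⟪x 0, y 0⟫_ℂ)).congr_left
      fun t => ?_
    rw [wordDiff_succ_apply, Fin.sum_univ_succ, prod_erase_zero fun j => ⟪x j, y j⟫_ℂ, prodInner]
    simp only [prod_erase_succ fun j => ⟪x j, y j⟫_ℂ, mul_smul, ← Finset.smul_sum, smul_sub]
    abel

theorem wordDiff_single (t : ℝ) (ε : ZMod 2) (x y : h) :
    wordDiff U t (fun _ : Fin 1 => ε) (fun _ => x) (fun _ => y) = incr U t ε x y := by
  simp [wordDiff, wordOp, prodInner, incr, matEl_sub_one]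

/-! ### Dependence on the operators `|x⟩⟨y|` -/

section KetBra

variable {n : ℕ}

theorem prod_inner_eq_of_ketBra_eq {x y x' y' : Fin n → h} (hxy : ketBra x y = ketBra x' y')
    (z w : Fin n → h) :
    (∏ i, ⟪y i, z i⟫_ℂ) * ∏ i, ⟪w i, x i⟫_ℂ = (∏ i, ⟪y' i, z i⟫_ℂ) * ∏ i, ⟪w i, x' i⟫_ℂ := by
  have := congrArg (bra w) (LinearMap.congr_fun hxy (PiTensorProduct.tprod ℂ z))
  simpa [ketBra] using this

/-- Freezing all slots except the `i`-th at the vectors `y j` leaves two proportional functionals,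
`⟪y i, ·⟫ * A` and `⟪y' i, ·⟫ * B`, with `A ≠ 0`. Then `B ≠ 0` too, as `y i ≠ 0`. -/
theorem exists_smul_of_prod_inner_eq {y y' : Fin n → h} {a b : ℂ} (ha : a ≠ 0)
    (hy : ∀ i, y i ≠ 0) (hyy : ∀ z : Fin n → h, (∏ i, ⟪y i, z i⟫_ℂ) * a = (∏ i, ⟪y' i, z i⟫_ℂ) * b) :
    ∃ μ : Fin n → ℂ, ∀ i, y' i = μ i • y i := by
  classical
  have key (i : Fin n) : ∃ μ : ℂ, y' i = μ • y i := by
    set A : ℂ := (∏ j ∈ Finset.univ.erase i, ⟪y j, y j⟫_ℂ) * a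
    set B : ℂ := (∏ j ∈ Finset.univ.erase i, ⟪y' j, y j⟫_ℂ) * b
    have hA : A ≠ 0 := mul_ne_zero (Finset.prod_ne_zero_iff.2 fun j _ => by simpa using hy j) ha
    have h1 (z : h) : ⟪y i, z⟫_ℂ * A = ⟪y' i, z⟫_ℂ * B := by
      have := hyy (Function.update y i z)
      rw [← Finset.mul_prod_erase _ _ (Finset.mem_univ i),
        ← Finset.mul_prod_erase _ _ (Finset.mem_univ i)] at this
      simp only [Function.update_self, mul_assoc] at this
      convert this using 3 <;>
      · refine Finset.prod_congr rfl fun j hj => ?_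
        rw [Function.update_of_ne (Finset.ne_of_mem_erase hj)]
    have h2 : star A • y i = star B • y' i := by
      refine ext_inner_right ℂ fun z => ?_
      simpa [inner_smul_left, mul_comm] using h1 z
    have hB : star B ≠ 0 := by
      intro hB
      rw [hB, zero_smul, smul_eq_zero] at h2
      exact h2.elim (by simpa using hA) (hy i)
    exact ⟨(star B)⁻¹ * star A, by rw [mul_smul, h2, smul_smul, inv_mul_cancel₀ hB, one_smul]⟩
  choose μ hμ using key
  exact ⟨μ, hμ⟩

/-- Testing against `y'` and `x'` themselves turns the right side into a product of squared norms,
which must vanish. -/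
theorem exists_eq_zero_of_ketBra_eq {x y x' y' : Fin n → h} (hxy : ketBra x y = ketBra x' y')
    (h0 : ∃ i, x i = 0 ∨ y i = 0) : ∃ i, x' i = 0 ∨ y' i = 0 := by
  have h1 := prod_inner_eq_of_ketBra_eq hxy y' x'
  have h2 : (∏ i, ⟪y i, y' i⟫_ℂ) * ∏ i, ⟪x' i, x i⟫_ℂ = 0 := by
    obtain ⟨i, hi | hi⟩ := h0
    · rw [Finset.prod_eq_zero (f := fun i => ⟪x' i, x i⟫_ℂ) (Finset.mem_univ i) (by simp [hi]),
        mul_zero]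
    · rw [Finset.prod_eq_zero (f := fun i => ⟪y i, y' i⟫_ℂ) (Finset.mem_univ i) (by simp [hi]),
        zero_mul]
  rw [h2, eq_comm, mul_eq_zero, Finset.prod_eq_zero_iff, Finset.prod_eq_zero_iff] at h1
  simp only [Finset.mem_univ, true_and, inner_self_eq_zero] at h1
  obtain ⟨i, hi⟩ | ⟨i, hi⟩ := h1
  exacts [⟨i, Or.inr hi⟩, ⟨i, Or.inl hi⟩]

/-- Product vectors with the same operator `|x⟩⟨y|` differ by scalar factors, unless that operator
vanishes. -/
theorem exists_smul_of_ketBra_eq {x y x' y' : Fin n → h} (hxy : ketBra x y = ketBra x' y') :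
    ((∃ i, x i = 0 ∨ y i = 0) ∧ ∃ i, x' i = 0 ∨ y' i = 0) ∨
      ∃ μ ν : Fin n → ℂ, (∀ i, x' i = ν i • x i) ∧ (∀ i, y' i = μ i • y i) ∧
        ∏ i, (starRingEnd ℂ (ν i) * μ i) = 1 := by
  by_cases h0 : ∃ i, x i = 0 ∨ y i = 0
  · exact Or.inl ⟨h0, exists_eq_zero_of_ketBra_eq hxy h0⟩
  right
  push Not at h0
  have key := prod_inner_eq_of_ketBra_eq hxy
  have hx : ∏ i, ⟪x i, x i⟫_ℂ ≠ 0 := Finset.prod_ne_zero_iff.2 fun j _ => by simpa using (h0 j).1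
  have hy : ∏ i, ⟪y i, y i⟫_ℂ ≠ 0 := Finset.prod_ne_zero_iff.2 fun j _ => by simpa using (h0 j).2
  obtain ⟨μ, hμ⟩ := exists_smul_of_prod_inner_eq hx (fun i => (h0 i).2) fun z => key z x
  -- The vectors `x` stand in the linear slot, so the identity is conjugated before the same lemma
  -- applies.
  obtain ⟨ν, hν⟩ := exists_smul_of_prod_inner_eq (y := x) (y' := x') (a := star (∏ i, ⟪y i, y i⟫_ℂ))
    (b := star (∏ i, ⟪y' i, y i⟫_ℂ)) (by simpa using hy) (fun i => (h0 i).1) fun z => by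
      have := congrArg star (key y z)
      simpa [mul_comm] using this
  refine ⟨μ, ν, hν, hμ, ?_⟩
  -- Testing at `y` and `x` fixes the total scalar; its conjugate is the required product.
  have h1 := key y x
  simp only [hμ, hν, inner_smul_left, inner_smul_right, Finset.prod_mul_distrib] at h1
  have h2 : (∏ i, starRingEnd ℂ (μ i)) * ∏ i, ν i = 1 := by
    refine mul_right_cancel₀ (mul_ne_zero hy hx) ?_
    rw [one_mul]
    refine Eq.trans ?_ h1.symm
    ring
  have h3 := congrArg (starRingEnd ℂ) h2
  simpa [Finset.prod_mul_distrib, mul_comm] using h3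

theorem wordOp_smul (s t : Fin n → ℝ) (ε : Fin n → ZMod 2) (x y : Fin n → h) (ν μ : Fin n → ℂ) :
    wordOp U s t ε (fun i => ν i • x i) (fun i => μ i • y i) =
      (∏ i, (starRingEnd ℂ (ν i) * μ i)) • wordOp U s t ε x y := by
  induction n with
  | zero => simp [wordOp]
  | succ n ih =>
    rw [wordOp_succ, ih, wordOp_succ, Fin.prod_univ_succ, matEl_smul_left, matEl_smul_right,
      smul_smul, smul_mul_smul_comm]

theorem wordOp_eq_zero (s t : Fin n → ℝ) (ε : Fin n → ZMod 2) {x y : Fin n → h}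
    (h0 : ∃ i, x i = 0 ∨ y i = 0) : wordOp U s t ε x y = 0 := by
  obtain ⟨i, hi⟩ := h0
  refine List.prod_eq_zero (List.mem_ofFn.2 ⟨i, ?_⟩)
  exact hi.elim (fun hi => matEl_eq_zero_of_left _ hi _) (matEl_eq_zero_of_right _ _)

theorem prodInner_smul (x y : Fin n → h) (ν μ : Fin n → ℂ) :
    prodInner (fun i => ν i • x i) (fun i => μ i • y i) =
      (∏ i, (starRingEnd ℂ (ν i) * μ i)) * prodInner x y := by
  rw [prodInner, prodInner, ← Finset.prod_mul_distrib]
  refine Finset.prod_congr rfl fun i _ => ?_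
  rw [inner_smul_left, inner_smul_right, mul_assoc]

theorem prodInner_eq_zero {x y : Fin n → h} (h0 : ∃ i, x i = 0 ∨ y i = 0) :
    prodInner x y = 0 := by
  obtain ⟨i, hi⟩ := h0
  exact Finset.prod_eq_zero (Finset.mem_univ i) (by rcases hi with hi | hi <;> simp [hi])

theorem prodInner_congr {x y x' y' : Fin n → h} (hxy : ketBra x y = ketBra x' y') :
    prodInner x y = prodInner x' y' := by
  obtain ⟨h1, h2⟩ | ⟨μ, ν, hx, hy, h1⟩ := exists_smul_of_ketBra_eq hxy
  · rw [prodInner_eq_zero h1, prodInner_eq_zero h2]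
  · rw [funext hx, funext hy, prodInner_smul, h1, one_mul]

/-- Words and their scalar parts scale by the same factor `∏ conj(ν i) * μ i`, which is `1`; if some
vector vanishes, both are zero. -/
theorem wordDiff_congr (t : ℝ) (ε : Fin n → ZMod 2) {x y x' y' : Fin n → h}
    (hxy : ketBra x y = ketBra x' y') : wordDiff U t ε x y = wordDiff U t ε x' y' := by
  rw [wordDiff, wordDiff, prodInner_congr hxy]
  obtain ⟨h1, h2⟩ | ⟨μ, ν, hx, hy, h1⟩ := exists_smul_of_ketBra_eq hxy
  · rw [wordOp_eq_zero _ _ _ h1, wordOp_eq_zero _ _ _ h2]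
  · rw [funext hx, funext hy, wordOp_smul, h1, one_smul]

end KetBra

/-! ### Hilbert spaces of kernels -/

/-- The form is a semi-inner product on `M`; the separated completion divides out its null vectors.
-/
theorem exists_hilbertSpace_of_kernel {M : Type u} [AddCommGroup M] [Module ℂ M]
    (K : M →ₗ⋆[ℂ] M →ₗ[ℂ] ℂ) (symm : ∀ a b, starRingEnd ℂ (K b a) = K a b)
    (nonneg : ∀ a, 0 ≤ (K a a).re) :
    ∃ (k : Type u) (_ : NormedAddCommGroup k) (_ : InnerProductSpace ℂ k) (_ : CompleteSpace k)
      (η : M →ₗ[ℂ] k), DenseRange η ∧ ∀ a b, ⟪η a, η b⟫_ℂ = K a b := by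
  let core : PreInnerProductSpace.Core ℂ M :=
    { inner := fun a b => K a b
      conj_inner_symm := symm
      re_inner_nonneg := nonneg
      add_left := fun a b c => by simp
      smul_left := fun a b r => by simp }
  let : SeminormedAddCommGroup M := @InnerProductSpace.Core.toSeminormedAddCommGroup ℂ M _ _ _ core
  let : InnerProductSpace ℂ M := InnerProductSpace.ofCore core
  refine ⟨UniformSpace.Completion M, inferInstance, inferInstance, inferInstance,
    (UniformSpace.Completion.toComplL (𝕜 := ℂ) (E := M)).toLinearMap,
    UniformSpace.Completion.denseRange_coe, fun a b => ?_⟩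
  exact UniformSpace.Completion.inner_coe a b

/-! ### The algebra of tuples -/

section TupleAlgebra

variable {D : Set h}

/-- The character `(x, y, ε) ↦ ⟪x, y⟫` on words. -/
def wordChar (D : Set h) : Words D →ₙ* ℂ where
  toFun := Quotient.lift (fun a : Tuple D => prodInner a.x a.y) (by
    rintro ⟨n, _, x, y, _, ε⟩ ⟨n', _, x', y', _, ε'⟩ ⟨e, h₁, h₂⟩
    dsimp only at e
    subst e
    exact prodInner_congr h₂)
  map_mul' := by
    rintro ⟨a⟩ ⟨b⟩
    exact prodInner_append a.x a.y b.x b.y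

/-- The representation `(x, y, ε) ↦ ⟪x, y⟫ 1` of the algebra of tuples. -/
def trivialRep (D : Set h) (k : Type*) [NormedAddCommGroup k] [InnerProductSpace ℂ k] :
    TupleAlgebra D →ₙₐ[ℂ] (k →L[ℂ] k) :=
  MonoidAlgebra.liftMagma ℂ
    { toFun := fun a => wordChar D a • (1 : k →L[ℂ] k)
      map_mul' := fun a b => by rw [map_mul, smul_mul_smul_comm, one_mul] }

theorem trivialRep_gen (k : Type*) [NormedAddCommGroup k] [InnerProductSpace ℂ k] (a : Tuple D) :
    trivialRep D k (gen a) = prodInner a.x a.y • (1 : k →L[ℂ] k) := by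
  rw [trivialRep, gen, MonoidAlgebra.liftMagma_apply_apply]
  simp
  rfl

theorem tupleAlgebra_induction {P : TupleAlgebra D → Prop} (zero : P 0)
    (add : ∀ a b, P a → P b → P (a + b)) (smul_gen : ∀ (c : ℂ) a, P (c • gen a))
    (m : TupleAlgebra D) : P m := by
  refine MonoidAlgebra.induction_linear m zero add fun q r => ?_
  induction q using Quotient.inductionOn with
  | h a => simpa [gen] using smul_gen r a

theorem span_range_gen : Submodule.span ℂ (Set.range (gen (D := D))) = ⊤ := by
  refine Submodule.eq_top_iff'.2 fun m => tupleAlgebra_induction (zero_mem _)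
    (fun a b => add_mem) (fun c a => Submodule.smul_mem _ _ ?_) m
  exact Submodule.subset_span ⟨a, rfl⟩

theorem span_range_map_gen {k : Type*} [NormedAddCommGroup k] [InnerProductSpace ℂ k]
    (η : TupleAlgebra D →ₗ[ℂ] k) :
    Submodule.span ℂ (Set.range fun a : Tuple D => η (gen a)) = LinearMap.range η := by
  rw [← Function.comp_def η gen, Set.range_comp, ← Submodule.map_span, span_range_gen,
    Submodule.map_top]

theorem total_iff_denseRange {k : Type*} [NormedAddCommGroup k] [InnerProductSpace ℂ k]
    (η : TupleAlgebra D →ₗ[ℂ] k) :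
    (Submodule.span ℂ (Set.range fun a : Tuple D => η (gen a))).topologicalClosure = ⊤ ↔
      DenseRange η := by
  rw [span_range_map_gen, ← Submodule.dense_iff_topologicalClosure_eq_top]
  rfl

/-- Noise spaces are unique up to unitary equivalence. -/
theorem IsNoiseSpace.exists_unitary {K : TupleAlgebra D → TupleAlgebra D → ℂ}
    {k k' : Type*} [NormedAddCommGroup k] [InnerProductSpace ℂ k] [CompleteSpace k]
    [NormedAddCommGroup k'] [InnerProductSpace ℂ k'] [CompleteSpace k']
    {η : TupleAlgebra D →ₗ[ℂ] k} {π : TupleAlgebra D →ₙₐ[ℂ] (k →L[ℂ] k)}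
    {η' : TupleAlgebra D →ₗ[ℂ] k'} {π' : TupleAlgebra D →ₙₐ[ℂ] (k' →L[ℂ] k')}
    (hη : IsNoiseSpace K η π) (hη' : IsNoiseSpace K η' π') :
    ∃ W : k ≃ₗᵢ[ℂ] k', (∀ a, W (η a) = η' a) ∧ ∀ a ξ, W (π a ξ) = π' a (W ξ) := by
  have hd := (total_iff_denseRange η).1 hη.total
  have hd' := (total_iff_denseRange η').1 hη'.total
  -- Both norms are read off from `K`, so `η m ↦ η' m` is a well-defined isometry between dense
  -- subspaces.
  have hn (m) : ‖η' (LinearEquiv.refl ℂ (TupleAlgebra D) m)‖ = ‖η m‖ := by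
    rw [LinearEquiv.refl_apply, ← sq_eq_sq₀ (norm_nonneg _) (norm_nonneg _),
      ← inner_self_eq_norm_sq (𝕜 := ℂ), ← inner_self_eq_norm_sq (𝕜 := ℂ), hη.inner_eq,
      hη'.inner_eq]
  let W := (LinearEquiv.refl ℂ (TupleAlgebra D)).extendOfIsometry η η' hd hd' hn
  have hW (m) : W (η m) = η' m := LinearEquiv.extendOfIsometry_eq _ _ _ hd hd' hn m
  refine ⟨W, hW, fun a ξ => ?_⟩
  -- The formula for `π` on the vectors `η (gen b)` involves only `η`, so `W` intertwines there;
  -- linearity and density do the rest.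
  have gens (a b : Tuple D) : W (π (gen a) (η (gen b))) = π' (gen a) (W (η (gen b))) := by
    rw [hη.rep, hW, hη'.rep, map_sub, map_smul, hW, hW]
  refine hd.induction_on (p := fun ξ => W (π a ξ) = π' a (W ξ)) ξ
    (isClosed_eq (by fun_prop) (by fun_prop)) fun m => ?_
  induction a using tupleAlgebra_induction with
  | zero => simp
  | add a a' h1 h2 => rw [map_add, map_add, add_apply, add_apply, map_add, h1, h2]
  | smul_gen c a =>
    rw [map_smul, map_smul, smul_apply, smul_apply, map_smul]
    congr 1
    induction m using tupleAlgebra_induction with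
    | zero => simp
    | add b b' h1 h2 => simp only [map_add, h1, h2]
    | smul_gen c b => simp only [map_smul, gens]

/-- The vectors `(U_t^(ε) - 1)(x, y) Ω`, extended linearly to the algebra of tuples. -/
def wordVec (U : ℝ → ℝ → HTensor h H →L[ℂ] HTensor h H) (Ω : H) (D : Set h) (t : ℝ) :
    TupleAlgebra D →ₗ[ℂ] H :=
  Finsupp.linearCombination ℂ
      (Quotient.lift (fun a : Tuple D => wordDiff U t a.ε a.x a.y Ω) (by
        rintro ⟨n, _, x, y, _, ε⟩ ⟨n', _, x', y', _, ε'⟩ ⟨e, h₁, h₂⟩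
        dsimp only at e
        subst e
        dsimp only at h₁ h₂ ⊢
        rw [show ε = ε' from h₁, wordDiff_congr t ε' h₂]
        rfl)) ∘ₗ
    (MonoidAlgebra.coeffLinearEquiv ℂ).toLinearMap

theorem wordVec_gen (t : ℝ) (a : Tuple D) :
    wordVec U Ω D t (gen a) = wordDiff U t a.ε a.x a.y Ω := by
  simp [wordVec, gen, MonoidAlgebra.coeffLinearEquiv]

theorem wordVec_single (t : ℝ) (x y : h) (hy : y ∈ D) (ε : ZMod 2) :
    wordVec U Ω D t (gen (Tuple.single x y hy ε)) = incr U t ε x y Ω := by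
  rw [wordVec_gen, ← wordDiff_single]
  rfl

end TupleAlgebra

/-! ### The kernel of the process -/

theorem incr_sub_left (t : ℝ) (ε : ZMod 2) (x x' y : h) :
    incr U t ε (x - x') y = incr U t ε x y - incr U t ε x' y := by
  rw [sub_eq_add_neg, ← neg_one_smul ℂ x', incr, matEl_add_left, matEl_smul_left]
  simp [incr, sub_eq_add_neg]

theorem incr_sub_right (t : ℝ) (ε : ZMod 2) (x y y' : h) :
    incr U t ε x (y - y') = incr U t ε x y - incr U t ε x y' := by
  rw [sub_eq_add_neg, ← neg_one_smul ℂ y', incr, matEl_add_right, matEl_smul_right]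
  simp [incr, sub_eq_add_neg]

theorem tendsto_inner_sum {ι κ : Type*} (s : Finset ι) (r : Finset κ) (c : ι → ℂ) (d : κ → ℂ)
    {f : ι → ℝ → H} {g : κ → ℝ → H}
    (hfg : ∀ i j, ∃ z, Tendsto (fun t : ℝ => (t : ℂ)⁻¹ * ⟪f i t, g j t⟫_ℂ) (𝓝[>] 0) (𝓝 z)) :
    ∃ z, Tendsto (fun t : ℝ => (t : ℂ)⁻¹ * ⟪∑ i ∈ s, c i • f i t, ∑ j ∈ r, d j • g j t⟫_ℂ)
      (𝓝[>] 0) (𝓝 z) := by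
  choose z hz using hfg
  have h1 := tendsto_finsetSum s fun i (_ : i ∈ s) => tendsto_finsetSum r fun j (_ : j ∈ r) =>
    (hz i j).const_mul (starRingEnd ℂ (c i) * d j)
  refine ⟨_, h1.congr fun t => ?_⟩
  simp only [sum_inner, inner_sum, inner_smul_left, inner_smul_right, Finset.mul_sum]
  rw [Finset.sum_comm]
  refine Finset.sum_congr rfl fun j _ => ?_
  refine Finset.sum_congr rfl fun i _ => ?_
  ring

/-- Sesquilinearity reduces to two tuples. Their vectors may be replaced by sums of single
increments, whose pairwise limits exist. -/
theorem exists_tendsto_wordVec (hA : IsUnitaryIncrementProcess U Ω) (hC : IsGaussian U Ω)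
    (hN : (spaceN U Ω : Set (h →L[ℂ] h)) ⊆ domL U Ω) (m m' : TupleAlgebra (domG U Ω)) :
    ∃ c, Tendsto (fun t : ℝ => (t : ℂ)⁻¹ * ⟪wordVec U Ω _ t m, wordVec U Ω _ t m'⟫_ℂ)
      (𝓝[>] 0) (𝓝 c) := by
  have sum_isBigO (a : Tuple (domG U Ω)) : (fun t => ∑ i, (∏ j ∈ Finset.univ.erase i,
      ⟪a.x j, a.y j⟫_ℂ) • incr U t (a.ε i) (a.x i) (a.y i) Ω) =O[𝓝[>] 0] fun t : ℝ => √t :=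
    IsBigO.fun_sum fun i _ => (incr_vacuum_isBigO hA _ _ (a.mem i)).const_smul_left _
  induction m using tupleAlgebra_induction with
  | zero => exact ⟨0, by simp⟩
  | add a a' h1 h2 =>
    obtain ⟨c, hc⟩ := h1
    obtain ⟨c', hc'⟩ := h2
    exact ⟨_, (hc.add hc').congr fun t => by rw [map_add, inner_add_left, mul_add]⟩
  | smul_gen c a =>
    induction m' using tupleAlgebra_induction with
    | zero => exact ⟨0, by simp⟩
    | add b b' h1 h2 =>
      obtain ⟨c, hc⟩ := h1
      obtain ⟨c', hc'⟩ := h2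
      exact ⟨_, (hc.add hc').congr fun t => by rw [map_add, inner_add_right, mul_add]⟩
    | smul_gen d b =>
      obtain ⟨z, hz⟩ := tendsto_inner_sum Finset.univ Finset.univ
        (fun i => ∏ j ∈ Finset.univ.erase i, ⟪a.x j, a.y j⟫_ℂ)
        (fun i => ∏ j ∈ Finset.univ.erase i, ⟪b.x j, b.y j⟫_ℂ)
        fun i j => tendsto_inner_incr hA hC hN (a.x i) (b.x j) (a.ε i) (b.ε j) (a.mem i) (b.mem j)
      have h1 := tendsto_inner_of_negligible_sub (negligible_wordDiff_sub_sum hA hC a.ε a.x a.y)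
        (negligible_wordDiff_sub_sum hA hC b.ε b.x b.y) (sum_isBigO a) (sum_isBigO b) hz
      refine ⟨_, (h1.const_mul (starRingEnd ℂ c * d)).congr fun t => ?_⟩
      rw [map_smul, map_smul, wordVec_gen, wordVec_gen, inner_smul_left, inner_smul_right]
      ring

/-- The vectors `wordVec` are linear in `m` for each fixed `t`, so sesquilinearity of the limit
follows from uniqueness of limits. -/
theorem exists_kernel (hA : IsUnitaryIncrementProcess U Ω) (hC : IsGaussian U Ω)
    (hN : (spaceN U Ω : Set (h →L[ℂ] h)) ⊆ domL U Ω) :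
    ∃ K : TupleAlgebra (domG U Ω) →ₗ⋆[ℂ] TupleAlgebra (domG U Ω) →ₗ[ℂ] ℂ, ∀ m m',
      Tendsto (fun t : ℝ => (t : ℂ)⁻¹ * ⟪wordVec U Ω _ t m, wordVec U Ω _ t m'⟫_ℂ)
        (𝓝[>] 0) (𝓝 (K m m')) := by
  choose K hK using exists_tendsto_wordVec hA hC hN
  refine ⟨LinearMap.mk₂'ₛₗ (starRingEnd ℂ) (RingHom.id ℂ) K ?_ ?_ ?_ ?_, hK⟩
  · refine fun a b c => tendsto_nhds_unique (hK _ _) (((hK a c).add (hK b c)).congr fun t => ?_)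
    rw [map_add, inner_add_left, mul_add]
  · refine fun r a b => tendsto_nhds_unique (hK _ _)
      (((hK a b).const_mul (starRingEnd ℂ r)).congr fun t => ?_)
    rw [map_smul, inner_smul_left]
    ring
  · refine fun a b c => tendsto_nhds_unique (hK _ _) (((hK a b).add (hK a c)).congr fun t => ?_)
    rw [map_add, inner_add_right, mul_add]
  · refine fun r a b => tendsto_nhds_unique (hK _ _) (((hK a b).const_mul r).congr fun t => ?_)
    rw [map_smul, inner_smul_right]
    ring

/-! ### Relations satisfied by the limit map, and separability. -/

section NoiseSpace

variable {k : Type*} [NormedAddCommGroup k] [InnerProductSpace ℂ k]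
  {η : TupleAlgebra (domG U Ω) →ₗ[ℂ] k}

/-- `η` is the linear map of a noise space: `⟪η m, η m'⟫` is the kernel. -/
def IsLimitMap (η : TupleAlgebra (domG U Ω) →ₗ[ℂ] k) : Prop :=
  ∀ m m', Tendsto (fun t : ℝ => (t : ℂ)⁻¹ * ⟪wordVec U Ω _ t m, wordVec U Ω _ t m'⟫_ℂ)
    (𝓝[>] 0) (𝓝 ⟪η m, η m'⟫_ℂ)

/-- `‖η m‖ ^ 2` is the limit of `t⁻¹ ‖wordVec m‖ ^ 2`. -/
theorem IsLimitMap.eq_zero (hη : IsLimitMap η) {m : TupleAlgebra (domG U Ω)}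
    (hm : Negligible fun t => wordVec U Ω _ t m) : η m = 0 :=
  inner_self_eq_zero.1 (tendsto_nhds_unique (hη m m)
    (tendsto_inv_mul_of_isLittleO (hm.inner_left hm.isBigO)))

theorem IsLimitMap.eq_of_negligible (hη : IsLimitMap η) {m m' : TupleAlgebra (domG U Ω)}
    (hm : Negligible fun t => wordVec U Ω _ t m - wordVec U Ω _ t m') : η m = η m' := by
  refine sub_eq_zero.1 ?_
  rw [← map_sub]
  exact hη.eq_zero (by simpa only [map_sub] using hm)

/-- The Leibniz rule in the limit. Subtracting the first term, as the formula for `π` prescribes,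
leaves a multiple of `η (gen b)`, hence the triviality of `π`. -/
theorem IsLimitMap.map_mul (hη : IsLimitMap η) (hA : IsUnitaryIncrementProcess U Ω)
    (hC : IsGaussian U Ω) (a b : Tuple (domG U Ω)) :
    η (gen a * gen b) =
      prodInner b.x b.y • η (gen a) + prodInner a.x a.y • η (gen b) := by
  rw [← map_smul, ← map_smul, ← map_add, gen_mul]
  refine hη.eq_of_negligible ((negligible_wordDiff_append_sub hA hC
    a.ε b.ε a.x a.y b.x b.y).congr_left fun t => ?_)
  rw [map_add, map_smul, map_smul, wordVec_gen, wordVec_gen, wordVec_gen, sub_sub]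
  rfl

theorem IsLimitMap.map_gen (hη : IsLimitMap η) (hA : IsUnitaryIncrementProcess U Ω)
    (hC : IsGaussian U Ω) (a : Tuple (domG U Ω)) :
    η (gen a) = ∑ i, (∏ j ∈ Finset.univ.erase i, ⟪a.x j, a.y j⟫_ℂ) •
      η (gen (Tuple.single (a.x i) (a.y i) (a.mem i) (a.ε i))) := by
  simp only [← map_smul, ← map_sum]
  refine hη.eq_of_negligible ((negligible_wordDiff_sub_sum hA hC a.ε a.x a.y).congr_left
    fun t => ?_)
  simp only [map_sum, map_smul, wordVec_single]
  rw [wordVec_gen]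

theorem IsLimitMap.map_single_one (hη : IsLimitMap η) (hA : IsUnitaryIncrementProcess U Ω)
    (hC : IsGaussian U Ω) (x y : h) (hy : y ∈ domG U Ω) :
    η (gen (Tuple.single x y hy 1)) = -η (gen (Tuple.single x y hy 0)) := by
  rw [← map_neg]
  refine hη.eq_of_negligible ((negligible_incr_add_incr hA hC x hy).congr_left fun t => ?_)
  rw [map_neg, wordVec_single, wordVec_single, sub_neg_eq_add, add_comm]

theorem IsLimitMap.total_single (hη : IsLimitMap η) (hA : IsUnitaryIncrementProcess U Ω)
    (hC : IsGaussian U Ω) (hd : DenseRange η) :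
    (Submodule.span ℂ {ξ : k | ∃ (x y : h) (hy : y ∈ domG U Ω),
      ξ = η (gen (Tuple.single x y hy 0))}).topologicalClosure = ⊤ := by
  rw [← total_iff_denseRange] at hd
  rw [eq_top_iff, ← hd]
  refine Submodule.topologicalClosure_mono (Submodule.span_le.2 ?_)
  rintro _ ⟨a, rfl⟩
  dsimp only
  rw [hη.map_gen hA hC]
  refine Submodule.sum_mem _ fun i _ => Submodule.smul_mem _ _ ?_
  have h0 : η (gen (Tuple.single (a.x i) (a.y i) (a.mem i) 0)) ∈
      Submodule.span ℂ {ξ : k | ∃ (x y : h) (hy : y ∈ domG U Ω),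
        ξ = η (gen (Tuple.single x y hy 0))} := Submodule.subset_span ⟨_, _, _, rfl⟩
  obtain hε | hε : a.ε i = 0 ∨ a.ε i = 1 := by
    generalize a.ε i = ε
    revert ε
    decide
  · rwa [hε]
  · rw [hε, hη.map_single_one hA hC]
    exact neg_mem h0

/-- The vacuum estimate divided by `t`, in the limit `t ↓ 0`; here `g` is `G y`. -/
theorem IsLimitMap.norm_single_le (hη : IsLimitMap η) (hA : IsUnitaryIncrementProcess U Ω)
    (x : h) {y g : h} (hy : y ∈ domG U Ω)
    (hg : Tendsto (fun t : ℝ => (t : ℂ)⁻¹ • (semiT U Ω t y - y)) (𝓝[>] 0) (𝓝 g)) :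
    ‖η (gen (Tuple.single x y hy 0))‖ ≤ √(‖x‖ ^ 2 * (2 * (‖y‖ * ‖g‖))) := by
  set m := gen (Tuple.single x y hy 0)
  refine Real.le_sqrt_of_sq_le ?_
  have h1 := (hη m m).norm
  have h2 : Tendsto (fun t : ℝ => ‖x‖ ^ 2 * (2 * (‖y‖ * ‖(t : ℂ)⁻¹ • (semiT U Ω t y - y)‖)))
      (𝓝[>] 0) (𝓝 (‖x‖ ^ 2 * (2 * (‖y‖ * ‖g‖)))) :=
    ((hg.norm.const_mul _).const_mul _).const_mul _
  rw [inner_self_eq_norm_sq_to_K, norm_pow, RCLike.norm_ofReal, abs_norm] at h1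
  refine le_of_tendsto_of_tendsto h1 h2 ?_
  filter_upwards [eventually_pos] with t ht
  rw [wordVec_single, inner_self_eq_norm_sq_to_K, norm_mul, norm_pow, RCLike.norm_ofReal, abs_norm,
    norm_smul]
  calc ‖(t : ℂ)⁻¹‖ * ‖incr U t 0 x y Ω‖ ^ 2
      ≤ ‖(t : ℂ)⁻¹‖ * (‖x‖ ^ 2 * (2 * (‖y‖ * ‖semiT U Ω t y - y‖))) := by
        gcongr
        exact norm_incr_vacuum_sq_le hA ht 0 x y
    _ = _ := by ring

/-- The norm bound involves `G y`, so continuity in `y` is obtained for the graph norm. Triples `(x,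
y, G y)` form a subset of the second countable space `h × h × h`, and the set in question is its
continuous image. -/
theorem IsLimitMap.isSeparable_single [TopologicalSpace.SeparableSpace h] (hη : IsLimitMap η)
    (hA : IsUnitaryIncrementProcess U Ω) :
    TopologicalSpace.IsSeparable {ξ : k | ∃ (x y : h) (hy : y ∈ domG U Ω),
      ξ = η (gen (Tuple.single x y hy 0))} := by
  have : SecondCountableTopology h := UniformSpace.secondCountable_of_separable h
  let X := {p : h × h × h // Tendsto (fun t : ℝ => (t : ℂ)⁻¹ • (semiT U Ω t p.2.1 - p.2.1))
    (𝓝[>] 0) (𝓝 p.2.2)}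
  have mem (p : X) : p.1.2.1 ∈ domG U Ω := ⟨_, p.2⟩
  let f : X → k := fun p => η (gen (Tuple.single p.1.1 p.1.2.1 (mem p) 0))
  have hX (p q : X) : Tendsto (fun t : ℝ => (t : ℂ)⁻¹ • (semiT U Ω t (p.1.2.1 - q.1.2.1) -
      (p.1.2.1 - q.1.2.1))) (𝓝[>] 0) (𝓝 (p.1.2.2 - q.1.2.2)) := by
    refine (p.2.sub q.2).congr fun t => ?_
    rw [map_sub, ← smul_sub]
    congr 1
    abel
  have mem_sub (p q : X) : p.1.2.1 - q.1.2.1 ∈ domG U Ω := ⟨_, hX p q⟩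
  -- Vary `x` first and `y` second; the identity already holds for the increments at every `t`.
  have hsub (p q : X) : f p - f q =
      η (gen (Tuple.single (p.1.1 - q.1.1) p.1.2.1 (mem p) 0)) +
        η (gen (Tuple.single q.1.1 (p.1.2.1 - q.1.2.1) (mem_sub p q) 0)) := by
    simp only [f, ← map_sub, ← map_add]
    refine hη.eq_of_negligible (negligible_zero.congr_left fun t => ?_)
    simp only [map_sub, map_add, wordVec_single, incr_sub_left, incr_sub_right, sub_apply]
    abel
  have hf : Continuous f := by
    refine continuous_iff_continuousAt.2 fun q => tendsto_iff_norm_sub_tendsto_zero.2 ?_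
    let B : X → ℝ := fun p => √(‖p.1.1 - q.1.1‖ ^ 2 * (2 * (‖p.1.2.1‖ * ‖p.1.2.2‖))) +
      √(‖q.1.1‖ ^ 2 * (2 * (‖p.1.2.1 - q.1.2.1‖ * ‖p.1.2.2 - q.1.2.2‖)))
    have hB : Continuous B := by fun_prop
    have hB0 : B q = 0 := by simp [B]
    refine squeeze_zero (fun _ => norm_nonneg _) (fun p => ?_) (hB0 ▸ hB.tendsto q)
    rw [hsub]
    exact (norm_add_le _ _).trans (add_le_add (hη.norm_single_le hA _ _ p.2)
      (hη.norm_single_le hA _ _ (hX p q)))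
  refine (TopologicalSpace.isSeparable_range hf).mono ?_
  rintro _ ⟨x, y, ⟨g, hg⟩, rfl⟩
  exact ⟨⟨(x, y, g), hg⟩, rfl⟩

theorem separableSpace_of_total {S : Set k} (hS : TopologicalSpace.IsSeparable S)
    (ht : (Submodule.span ℂ S).topologicalClosure = ⊤) : TopologicalSpace.SeparableSpace k := by
  have := (TopologicalSpace.IsSeparable.span (R := ℂ) hS).closure
  rw [← Submodule.topologicalClosure_coe, ht, Submodule.top_coe] at this
  exact TopologicalSpace.isSeparable_univ_iff.1 this

end NoiseSpace

end Complete

end NoiseSpace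

end

/-! ### The noise space and its uniqueness. -/

open NoiseSpace in
theorem proposition4p1 {h : Type u} {H : Type v}
    [NormedAddCommGroup h] [InnerProductSpace ℂ h] [CompleteSpace h]
    [TopologicalSpace.SeparableSpace h]
    [NormedAddCommGroup H] [InnerProductSpace ℂ H] [CompleteSpace H]
    [TopologicalSpace.SeparableSpace H]
    (U : ℝ → ℝ → HTensor h H →L[ℂ] HTensor h H) (Ω : H)
    (hA : IsUnitaryIncrementProcess U Ω) (hB : IsWeaklyContinuous U Ω)
    (hC : IsGaussian U Ω) (hD : IsMinimal U Ω)
    (hN : (spaceN U Ω : Set (h →L[ℂ] h)) ⊆ domL U Ω) :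
    ∃ K : TupleAlgebra (domG U Ω) →ₗ⋆[ℂ] TupleAlgebra (domG U Ω) →ₗ[ℂ] ℂ,
      -- `K` is well defined and positive definite
      IsKernelOf U Ω K ∧ IsPositiveDefiniteKernel (fun a b => K a b) ∧
      -- existence of the noise space
      ∃ (k : Type u) (_ : NormedAddCommGroup k) (_ : InnerProductSpace ℂ k) (_ : CompleteSpace k)
        (η : TupleAlgebra (domG U Ω) →ₗ[ℂ] k)
        (π : TupleAlgebra (domG U Ω) →ₙₐ[ℂ] (k →L[ℂ] k)),
        TopologicalSpace.SeparableSpace k ∧ IsNoiseSpace (fun a b => K a b) η π ∧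
        -- its uniqueness up to unitary equivalence
        (∀ (k' : Type w) [NormedAddCommGroup k'] [InnerProductSpace ℂ k'] [CompleteSpace k']
          (η' : TupleAlgebra (domG U Ω) →ₗ[ℂ] k')
          (π' : TupleAlgebra (domG U Ω) →ₙₐ[ℂ] (k' →L[ℂ] k')),
          IsNoiseSpace (fun a b => K a b) η' π' →
          ∃ W : k ≃ₗᵢ[ℂ] k', (∀ a, W (η a) = η' a) ∧ ∀ a ξ, W (π a ξ) = π' a (W ξ)) ∧
        -- the representation is trivial
        (∀ a : Tuple (domG U Ω), π (gen a) = prodInner a.x a.y • (1 : k →L[ℂ] k)) ∧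
        -- decomposition into single factors
        (∀ a : Tuple (domG U Ω), η (gen a) =
          ∑ i, (∏ j ∈ Finset.univ.erase i, ⟪a.x j, a.y j⟫_ℂ) •
            η (gen (Tuple.single (a.x i) (a.y i) (a.mem i) (a.ε i)))) ∧
        -- the adjoint flips the sign
        (∀ (x y : h) (hy : y ∈ domG U Ω),
          η (gen (Tuple.single x y hy 1)) = -η (gen (Tuple.single x y hy 0))) ∧
        -- totality of the `η (x, y)`
        (Submodule.span ℂ {ξ : k | ∃ (x y : h) (hy : y ∈ domG U Ω),
          ξ = η (gen (Tuple.single x y hy 0))}).topologicalClosure = ⊤ := by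
  obtain ⟨K, hK⟩ := exists_kernel hA hC hN
  have symm (a b) : starRingEnd ℂ (K b a) = K a b := by
    refine tendsto_nhds_unique ((hK b a).star.congr fun t => ?_) (hK a b)
    rw [star_mul', Complex.star_def, inner_conj_symm, map_inv₀, Complex.conj_ofReal]
  have nonneg (a) : 0 ≤ (K a a).re := by
    refine ge_of_tendsto ((Complex.continuous_re.tendsto _).comp (hK a a)) ?_
    filter_upwards [eventually_pos] with t ht
    rw [Function.comp_apply, ← Complex.ofReal_inv, Complex.re_ofReal_mul]
    exact mul_nonneg (inv_nonneg.2 ht.le) (inner_self_nonneg (𝕜 := ℂ))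
  obtain ⟨k, i₁, i₂, i₃, η, hd, hη⟩ := exists_hilbertSpace_of_kernel K symm nonneg
  have hl : IsLimitMap η := fun m m' => by simpa only [hη] using hK m m'
  have ht := hl.total_single hA hC hd
  -- The trivial representation is taken as `π`; the Leibniz rule for `η` shows that it satisfies
  -- the required formula.
  have hn : IsNoiseSpace (fun a b => K a b) η (trivialRep (domG U Ω) k) :=
    { total := (total_iff_denseRange η).2 hd
      inner_eq := hη
      rep := fun a b => by
        rw [hl.map_mul hA hC, trivialRep_gen, add_sub_cancel_left]
        rfl }
  refine ⟨K, fun a b => by simpa only [wordVec_gen] using hK (gen a) (gen b), fun n m => ?_,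
    k, i₁, i₂, i₃, η, trivialRep (domG U Ω) k,
    separableSpace_of_total (hl.isSeparable_single hA) ht, hn, ?_, trivialRep_gen k,
    hl.map_gen hA hC, hl.map_single_one hA hC, ht⟩
  -- Kernel matrices are Gram matrices of the vectors `η (m i)`.
  · simpa only [Matrix.gram, hη] using Matrix.posSemidef_gram ℂ (fun i => η (m i))
  · intro k' _ _ _ η' π' hn'
    exact hn.exists_unitary hn'
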